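/- All graphs are finite and simple. For $t\ge 1$ let $s_t(G)$ be the number of $t$-stars of $G$, i.e. of subgraphs of $G$ isomorphic to $K_{1,t}$ (so $s_t(G)=\sum_v\binom{d(v)}{t}$ for $t\ge 2$ and $s_1(G)=e(G)$). For integers $-1\le \ell\le n-3$ and $1\le i\le \frac{n-1-\ell}{2}$ let $G^\ell_n(i)=K_{i+\ell}+(I_i\cup K_{n-2i-\ell})$, where $I_i$ is the empty graph on $i$ vertices, $\cup$ is disjoint union and $+$ is the join (if $i+\ell=0$, it is $I_1\cup K_{n-1}$), and let $\mathcal G^\ell_n(i)$ be the set of all spanning subgraphs of $G^\ell_n(i)$ in which the only edges allowed to be missing are those of the $K_{n-2i-\ell}$. A graph is traceable if it has a Hamilton path; Hamiltonian-connected if every two distinct vertices are joined by a Hamilton path; $k$-edge Hamiltonian if every linear forest in it with at most $k$ edges is contained in a Hamilton cycle; $k$-Hamiltonian if removing any set of at most $k$ vertices leaves a Hamiltonian graph. **Theorem.** Let $P$ be one of the following properties, with the given value of $\ell$: Hamiltonian ($\ell=0$); traceable ($\ell=-1$); Hamiltonian-connected ($\ell=1$); $k$-edge Hamiltonian ($\ell=k$);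 $k$-Hamiltonian ($\ell=k$), where in the last two cases $k\ge 1$ is an integer. Let $n$ satisfy $\ell\le n-3$, let $t\in\{1,\dots,n-1\}$ and $0\le d\le\lfloor\frac{n+\ell-1}{2}\rfloor$, and put $i_0=\lfloor\frac{n-1-\ell}{2}\rfloor$ and $i_d=\max\{1,d-\ell\}$. Then every $n$-vertex graph $G$ with minimum degree at least $d$ that does not have property $P$ satisfies $$s_t(G)\le \max\{s_t(G^\ell_n(i_d)),\,s_t(G^\ell_n(i_0))\}.$$ Call such a graph $G$ *extremal* if equality holds. Up to isomorphism, the extremal graphs are as follows. 1. If $s_t(G^\ell_n(i_d))<s_t(G^\ell_n(i_0))$: for $t\le n-i_0-1$, $G^\ell_n(i_0)$ is the unique extremal graph; for $t>n-i_0-1$, the set of extremal graphs is precisely $\mathcal G^\ell_n(i_0)$. 2. If $s_t(G^\ell_n(i_d))>s_t(G^\ell_n(i_0))$: for $t\le n-i_d-1$, $G^\ell_n(i_d)$ is the unique extremal graph; for $t>n-i_d-1$, the set of extremal graphs is precisely $\mathcal G^\ell_n(i_d)$. 3. If $s_t(G^\ell_n(i_d))=s_t(G^\ell_n(i_0))$: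 for $t\le n-i_0-1$, the set of extremal graphs is $\{G^\ell_n(i_d),G^\ell_n(i_0)\}$; for $n-i_0-1<t\le n-i_d-1$, it is $\mathcal G^\ell_n(i_0)\cup\{G^\ell_n(i_d)\}$; for $t>n-i_d-1$, it is $\mathcal G^\ell_n(i_d)\cup\mathcal G^\ell_n(i_0)$. -/

import Mathlib

noncomputable section

namespace StarsHam

/-- The five Hamiltonicity-like properties of finite graphs. -/
inductive HamProperty : Type
  | hamiltonian
  | traceable
  | hamiltonianConnected
  | edgeHamiltonian (k : ℕ)
  | vertexHamiltonian (k : ℕ)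

section Properties

variable {V : Type*} [Fintype V]

open Classical in
/-- `G` contains a Hamilton path. -/
def IsTraceable (G : SimpleGraph V) : Prop :=
  ∃ (u v : V) (p : G.Walk u v), p.IsHamiltonian

open Classical in
/-- Every two distinct vertices are the ends of a Hamilton path. -/
def IsHamiltonianConnected (G : SimpleGraph V) : Prop :=
  ∀ u v : V, u ≠ v → ∃ p : G.Walk u v, p.IsHamiltonian

/-- `F` is a linear forest, i.e. a disjoint union of paths (possibly with isolated vertices):
an acyclic graph in which every vertex has at most two neighbours. -/
def IsLinearForest (F : SimpleGraph V) : Prop :=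
  F.IsAcyclic ∧ ∀ v : V, (F.neighborSet v).ncard ≤ 2

open Classical in
/-- `G` is `k`-edge Hamiltonian: every linear forest in `G` with at most `k` edges is contained
in a Hamilton cycle of `G`. -/
def IsEdgeHamiltonian (k : ℕ) (G : SimpleGraph V) : Prop :=
  ∀ F : SimpleGraph V, F ≤ G → IsLinearForest F → F.edgeSet.ncard ≤ k →
    ∃ (a : V) (p : G.Walk a a), p.IsHamiltonianCycle ∧ ∀ e ∈ F.edgeSet, e ∈ p.edges

open Classical in
/-- `G` is `k`-Hamiltonian: removing any set of at most `k` vertices leaves a Hamiltonian graph. -/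
def IsVertexHamiltonian (k : ℕ) (G : SimpleGraph V) : Prop :=
  ∀ S : Finset V, S.card ≤ k → (G.induce {v : V | v ∉ S}).IsHamiltonian

open Classical in
/-- The graph `G` has the property `P`. -/
def HamProperty.Holds (P : HamProperty) (G : SimpleGraph V) : Prop :=
  match P with
  | .hamiltonian => G.IsHamiltonian
  | .traceable => IsTraceable G
  | .hamiltonianConnected => IsHamiltonianConnected G
  | .edgeHamiltonian k => IsEdgeHamiltonian k G
  | .vertexHamiltonian k => IsVertexHamiltonian k G

end Properties

/-- The parameter `ℓ` attached to each of the properties. -/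
def HamProperty.ell : HamProperty → ℤ
  | .hamiltonian => 0
  | .traceable => -1
  | .hamiltonianConnected => 1
  | .edgeHamiltonian k => k
  | .vertexHamiltonian k => k

/-- In `k`-edge Hamiltonicity and `k`-Hamiltonicity the parameter `k` is positive. -/
def HamProperty.PosParam : HamProperty → Prop
  | .hamiltonian => True
  | .traceable => True
  | .hamiltonianConnected => True
  | .edgeHamiltonian k => 1 ≤ k
  | .vertexHamiltonian k => 1 ≤ k

/-- The part `A` (the first `i + ℓ` vertices), carrying the `K_{i+ℓ}`. -/
def InA (n : ℕ) (ℓ i : ℤ) (v : Fin n) : Prop := ((v : ℕ) : ℤ) < i + ℓ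

/-- The part `B` (the last `n - 2i - ℓ` vertices), carrying the `K_{n-2i-ℓ}`. The `i` vertices
that lie neither in `A` nor in `B` form the independent set `I_i`. -/
def InB (n : ℕ) (ℓ i : ℤ) (v : Fin n) : Prop := 2 * i + ℓ ≤ ((v : ℕ) : ℤ)

/-- The graph `G^ℓ_n(i) = K_{i+ℓ} + (I_i ∪ K_{n-2i-ℓ})`,
for `-1 ≤ ℓ ≤ n - 3` and `1 ≤ i ≤ (n-1-ℓ)/2`. -/
def baseGraph (n : ℕ) (ℓ i : ℤ) : SimpleGraph (Fin n) where
  Adj u v := u ≠ v ∧ (InA n ℓ i u ∨ InA n ℓ i v ∨ (InB n ℓ i u ∧ InB n ℓ i v))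
  symm := ⟨fun _ _ h => ⟨h.1.symm, by tauto⟩⟩
  loopless := ⟨fun _ h => h.1 rfl⟩

/-- The family `𝒢^ℓ_n(i)`: the spanning subgraphs of `G^ℓ_n(i)` that may miss only edges with
both ends in `B`. -/
def family (n : ℕ) (ℓ i : ℤ) : Set (SimpleGraph (Fin n)) :=
  {H | H ≤ baseGraph n ℓ i ∧
    ∀ u v, (baseGraph n ℓ i).Adj u v → ¬ H.Adj u v → InB n ℓ i u ∧ InB n ℓ i v}

/-- The number `s_t(G)` of `t`-stars in `G`, i.e. of subgraphs of `G` isomorphic to `K_{1,t}`. -/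
def starCount {V : Type*} [Fintype V] (t : ℕ) (G : SimpleGraph V) : ℕ :=
  G.copyCount (completeBipartiteGraph (Fin 1) (Fin t))

/-- The top index `i_0 = ⌊(n-1-ℓ)/2⌋` (integer division by `2` is the floor). -/
def iTop (n : ℕ) (ℓ : ℤ) : ℤ := ((n : ℤ) - 1 - ℓ) / 2

/-- The index `i_d = max {1, d - ℓ}`. -/
def iDeg (d : ℕ) (ℓ : ℤ) : ℤ := max 1 ((d : ℤ) - ℓ)

/-- The bound `max {s_t(G^ℓ_n(i_d)), s_t(G^ℓ_n(i_0))}`. -/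
def starBound (n : ℕ) (ℓ : ℤ) (d t : ℕ) : ℕ :=
  max (starCount t (baseGraph n ℓ (iDeg d ℓ))) (starCount t (baseGraph n ℓ (iTop n ℓ)))

open Classical in
/-- The graphs on `V` with minimum degree at least `d` that do not have the property `P`. -/
def admissible (V : Type*) [Fintype V] (P : HamProperty) (d : ℕ) : Set (SimpleGraph V) :=
  {G | d ≤ G.minDegree ∧ ¬ P.Holds G}

/-- The extremal graphs on `V`: the admissible graphs whose number of `t`-stars is equal to the
bound. -/
def extremal (V : Type*) [Fintype V] (P : HamProperty) (d t : ℕ) : Set (SimpleGraph V) :=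
  {G | G ∈ admissible V P d ∧ starCount t G = starBound (Fintype.card V) P.ell d t}

/-- The graphs on `V` that are isomorphic to `G`. -/
def copiesOf (V : Type*) {W : Type*} (G : SimpleGraph W) : Set (SimpleGraph V) :=
  {H | Nonempty (H ≃g G)}

/-- The graphs on `V` that are isomorphic to a member of `𝒢`. -/
def copiesOfFamily (V : Type*) {W : Type*} (𝒢 : Set (SimpleGraph W)) : Set (SimpleGraph V) :=
  {H | ∃ G ∈ 𝒢, Nonempty (H ≃g G)}

end StarsHam

end

/-! Up to a factor depending only on t, `starCount` is the sum of d(v).choose t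
(`starCount_mul_card_aut`), so the problem concerns degrees alone.

Upper bound. Write n for the number of vertices. Each property is stable: an edge between vertices
whose degrees in the graph without that edge sum to at least n + ℓ can be deleted without losing it
(`HamProperty.holds_of_sup_edge`). All five cases reduce to one exchange argument for Hamilton
cycles through a prescribed edge set. In an edge-maximal graph without P, nonadjacent vertices
therefore have degree sum below n + ℓ, and Chvátal's argument (`HamProperty.exists_degree_bound`)
yields an index i with at least i vertices of degree at most i + ℓ and at least n - i - ℓ vertices
of degree at most n - i - 1. Hence the degrees are dominated, vertex by vertex under a suitable
matching, by those of G^ℓ_n(i), and `degreeChooseSum_le_splitValue` bounds the star count by that of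
G^ℓ_n(i). The minimum degree forces i_d ≤ i, and i ≤ i_0 always.

Reduction to the ends. As a function of i, the star count of G^ℓ_n(i) is strictly quasi-convex
(`splitValue_lt_max`), so an index strictly between i_d and i_0 stays below the maximum
(`lt_max_of_quasiconvex`).

Equality. Termwise equality makes the dominating vertices A adjacent to everything and confines the
neighbours of I to A. The remaining part B must be complete as long as t ≤ n - i - 1; for larger t
its vertices are centres of no t-star and its inner edges are free
(`isSplit_of_degreeChooseSum_eq`). Conversely, every graph with such a partition lacks P, because a
Hamilton cycle cannot serve I and B from so small a set A (`IsSplit.not_holds`). `mem_extremal_iff`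
puts the pieces together. -/

noncomputable section

namespace StarsHam

open Finset

/-! ### Counting stars through vertex degrees. -/

section StarCount

open SimpleGraph

variable {V W : Type*} [Fintype V] [Fintype W]

open Classical in
instance automorphismFintype (H : SimpleGraph W) : Fintype (H ≃g H) :=
  Fintype.ofInjective (fun σ => (σ : W → W)) DFunLike.coe_injective

open Classical in
/-- The copies with the same image as a given one arise from it by automorphisms. -/
theorem card_copies_same_toSubgraph {G : SimpleGraph V} {H : SimpleGraph W} (f₀ : Copy H G) :
    #{f : Copy H G | f.toSubgraph = f₀.toSubgraph} = Fintype.card (H ≃g H) := by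
  have key : ∀ (f : Copy H G) (x y : W), f.toSubgraph.Adj (f x) (f y) ↔ H.Adj x y := by
    intro f x y
    simp only [Copy.toSubgraph, Subgraph.map_adj, Relation.Map, Subgraph.top_adj]
    constructor
    · rintro ⟨a, b, hab, ha, hb⟩
      have ha' : a = x := f.injective ha
      have hb' : b = y := f.injective hb
      rwa [← ha', ← hb']
    · intro h
      exact ⟨x, y, h, rfl, rfl⟩
  have hverts : ∀ f : Copy H G, f.toSubgraph.verts = Set.range f := by
    intro f
    simp only [Copy.toSubgraph, Subgraph.map_verts, Subgraph.verts_top, Set.image_univ]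
    rfl
  have hinj : Function.Injective (fun σ : H ≃g H => f₀.comp σ.toCopy) := by
    intro σ τ h
    ext x
    apply f₀.injective
    exact DFunLike.congr_fun h x
  rw [← Finset.card_univ, ← Finset.card_image_of_injective _ hinj]
  congr 1
  ext f
  simp only [mem_filter, mem_univ, true_and, mem_image]
  constructor
  · intro hf
    have hr : Set.range f = Set.range f₀ := by rw [← hverts, ← hverts, hf]
    let e : W ≃ W := ((Equiv.ofInjective f f.injective).trans (Equiv.setCongr hr)).trans
      (Equiv.ofInjective f₀ f₀.injective).symm
    have he : ∀ x, f₀ (e x) = f x := by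
      intro x
      have := Equiv.apply_symm_apply (Equiv.ofInjective f₀ f₀.injective)
        (Equiv.setCongr hr (Equiv.ofInjective f f.injective x))
      exact congrArg Subtype.val this
    refine ⟨⟨e, ?_⟩, ?_⟩
    · intro x y
      rw [← key f₀, ← key f, he, he, hf]
    · ext x
      exact he x
  · rintro ⟨σ, rfl⟩
    ext x y
    · rw [hverts, hverts]
      constructor
      · rintro ⟨w, rfl⟩
        exact ⟨σ w, rfl⟩
      · rintro ⟨w, rfl⟩
        exact ⟨σ.symm w, congrArg f₀ (σ.apply_symm_apply w)⟩
    · simp only [Copy.toSubgraph, Subgraph.map_adj, Relation.Map, Subgraph.top_adj]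
      constructor
      · rintro ⟨a, b, hab, rfl, rfl⟩
        exact ⟨σ a, σ b, σ.map_rel_iff.2 hab, rfl, rfl⟩
      · rintro ⟨a, b, hab, rfl, rfl⟩
        exact ⟨σ.symm a, σ.symm b, σ.symm.map_rel_iff.2 hab,
          congrArg f₀ (σ.apply_symm_apply a), congrArg f₀ (σ.apply_symm_apply b)⟩

open Classical in
theorem card_copy_eq (G : SimpleGraph V) (H : SimpleGraph W) :
    Nat.card (Copy H G) = G.copyCount H * Fintype.card (H ≃g H) := by
  rw [Nat.card_eq_fintype_card, copyCount_eq_card_image_copyToSubgraph, ← Finset.card_univ,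
    Finset.card_eq_sum_card_image Copy.toSubgraph, Finset.sum_const_nat]
  intro S hS
  obtain ⟨f₀, -, rfl⟩ := mem_image.1 hS
  exact card_copies_same_toSubgraph f₀

open Classical in
/-- A copy of a star is a centre together with an injective choice of leaves. -/
def starCopyEquiv (t : ℕ) (G : SimpleGraph V) :
    Copy (completeBipartiteGraph (Fin 1) (Fin t)) G ≃ Σ v : V, (Fin t ↪ G.neighborSet v) where
  toFun f := ⟨f (Sum.inl 0),
    ⟨fun j => ⟨f (Sum.inr j), f.toHom.map_adj (by simp)⟩, fun a b h => by
      have := f.injective (congrArg Subtype.val h)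
      simpa using this⟩⟩
  invFun p :=
    { toHom :=
        { toFun := Sum.elim (fun _ => p.1) (fun j => (p.2 j : V))
          map_rel' := by
            rintro (a | a) (b | b) h
            · simp at h
            · exact (p.2 b).2
            · exact (p.2 a).2.symm
            · simp at h }
      injective' := by
        rintro (a | a) (b | b) h
        · rw [Subsingleton.elim a b]
        · exact absurd h (G.ne_of_adj (p.2 b).2)
        · exact absurd h.symm (G.ne_of_adj (p.2 a).2)
        · rw [p.2.injective (Subtype.ext h)] }
  left_inv f := by
    ext x
    rcases x with x | x
    · rw [Subsingleton.elim x 0]; rfl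
    · rfl
  right_inv p := rfl

/-- The sum of `d(v).choose t` over the vertices. -/
def degreeChooseSum (t : ℕ) (G : SimpleGraph V) : ℕ :=
  ∑ v, ((G.neighborSet v).ncard).choose t

-- A vertex v is the centre of t! * d(v).choose t labelled stars. The automorphism group is left
-- unevaluated: its order is t! for t ≥ 2 but 2 for t = 1, so this form covers the number of edges
-- without a case distinction. Comparisons of star counts only need that order to be positive.
open Classical in
theorem starCount_mul_card_aut (t : ℕ) (G : SimpleGraph V) :
    starCount t G * Fintype.card (completeBipartiteGraph (Fin 1) (Fin t) ≃g
      completeBipartiteGraph (Fin 1) (Fin t)) = t.factorial * degreeChooseSum t G := by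
  rw [starCount, ← card_copy_eq, Nat.card_congr (starCopyEquiv t G), Nat.card_eq_fintype_card,
    Fintype.card_sigma, degreeChooseSum, Finset.mul_sum]
  refine Finset.sum_congr rfl fun v _ => ?_
  rw [Fintype.card_embedding_eq, Fintype.card_fin, Nat.descFactorial_eq_factorial_mul_choose,
    Set.ncard_eq_toFinset_card', Set.toFinset_card]

theorem starCount_le_iff (t : ℕ) (G : SimpleGraph V) (H : SimpleGraph W) :
    starCount t G ≤ starCount t H ↔ degreeChooseSum t G ≤ degreeChooseSum t H := by
  classical
  have h1 := starCount_mul_card_aut t G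
  have h2 := starCount_mul_card_aut t H
  have hpos : 0 < Fintype.card (completeBipartiteGraph (Fin 1) (Fin t) ≃g
      completeBipartiteGraph (Fin 1) (Fin t)) := Fintype.card_pos_iff.2 ⟨SimpleGraph.Iso.refl⟩
  rw [← Nat.mul_le_mul_right_iff hpos, h1, h2, Nat.mul_le_mul_left_iff t.factorial_pos]

theorem starCount_lt_iff (t : ℕ) (G : SimpleGraph V) (H : SimpleGraph W) :
    starCount t G < starCount t H ↔ degreeChooseSum t G < degreeChooseSum t H := by
  rw [← not_le, ← not_le, starCount_le_iff]

theorem starCount_eq_iff (t : ℕ) (G : SimpleGraph V) (H : SimpleGraph W) :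
    starCount t G = starCount t H ↔ degreeChooseSum t G = degreeChooseSum t H := by
  simp only [le_antisymm_iff, starCount_le_iff]

end StarCount

/-! ### Hamilton cycles as cyclic orderings, and the exchange argument. -/

section HamiltonLists

open SimpleGraph Classical

variable {W : Type*}

/-- `H` has a Hamilton cycle through all the edges in `F`, presented as a cyclic ordering of the
vertices. -/
def HasHamCycleThrough (H : SimpleGraph W) (F : Set (Sym2 W)) : Prop :=
  ∃ l : List W, l.Nodup ∧ (∀ w, w ∈ l) ∧ (∀ w, H.Adj w (l.formPerm w)) ∧
    ∀ e ∈ F, ∃ w, e = s(w, l.formPerm w)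

theorem length_eq_card_of_nodup [Fintype W] {l : List W} (hl : l.Nodup) (h : ∀ w, w ∈ l) :
    l.length = Fintype.card W := by
  rw [← List.toFinset_card_of_nodup hl, ← Finset.card_univ]
  congr 1
  ext w
  simp [h w]

/-- The support of a closed walk lists its base vertex at both ends; dropping the first entry leaves
the cyclic ordering, shifted by one against `getVert`. -/
theorem hasHamCycleThrough_of_walk {H : SimpleGraph W} {F : Set (Sym2 W)} {a : W}
    (p : H.Walk a a) (hp : p.IsHamiltonianCycle) (hF : ∀ e ∈ F, e ∈ p.edges) :
    HasHamCycleThrough H F := by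
  obtain ⟨hc, hcount⟩ :=
    Walk.isHamiltonianCycle_iff_isCycle_and_support_count_tail_eq_one.1 hp
  have hnd : p.support.tail.Nodup := hc.support_nodup
  have hmem : ∀ w, w ∈ p.support.tail := fun w => by
    rw [← List.count_pos_iff, hcount w]; exact one_pos
  have h3 : 3 ≤ p.length := hc.three_le_length
  have hlen : p.support.tail.length = p.length := by simp
  have hget : ∀ i (hi : i < p.support.tail.length), p.support.tail[i] = p.getVert (i + 1) := by
    intro i hi
    rw [List.getElem_tail, Walk.support_getElem_eq_getVert]
  have hnext : ∀ i, i < p.length →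
      p.support.tail.formPerm (p.getVert i) = p.getVert (i + 1) := by
    intro i hi
    rcases Nat.eq_zero_or_pos i with rfl | hpos
    · have h0 : p.getVert 0 = p.support.tail[p.length - 1]'(by omega) := by
        rw [hget]
        rw [show p.length - 1 + 1 = p.length by omega]
        simp
      rw [h0, List.formPerm_apply_getElem _ hnd, hget]
      congr 1
      rw [hlen, show p.length - 1 + 1 = p.length by omega, Nat.mod_self]
    · obtain ⟨j, rfl⟩ : ∃ j, i = j + 1 := ⟨i - 1, by omega⟩
      rw [← hget j (by omega), List.formPerm_apply_lt_getElem _ hnd _ (by omega), hget]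
  refine ⟨p.support.tail, hnd, hmem, ?_, ?_⟩
  · intro w
    obtain ⟨i, hi, rfl⟩ := List.getElem_of_mem (hmem w)
    rw [hget]
    by_cases h : i + 1 < p.length
    · rw [hnext _ h]
      exact p.adj_getVert_succ h
    · rw [show i + 1 = p.length by omega]
      have h0 : p.getVert p.length = p.getVert 0 := by simp
      rw [h0, hnext 0 (by omega)]
      exact p.adj_getVert_succ (by omega)
  · intro e he
    have he' := hF e he
    induction e with
    | _ x y =>
      obtain ⟨i, hi, h⟩ := (Walk.mk_mem_edges_iff_exists p).1 he'
      exact ⟨p.getVert i, by rw [hnext i hi, h]⟩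

variable [Fintype W]

/-- At least three vertices are needed: on two adjacent vertices `formPerm` is a swap, so a single
edge would pass for a cyclic ordering. -/
theorem exists_walk_of_hasHamCycleThrough {H : SimpleGraph W} {F : Set (Sym2 W)}
    (h3 : 3 ≤ Fintype.card W) (h : HasHamCycleThrough H F) :
    ∃ (a : W) (p : H.Walk a a), p.IsHamiltonianCycle ∧ ∀ e ∈ F, e ∈ p.edges := by
  obtain ⟨l, hnd, hmem, hadj, hF⟩ := h
  have hlen := length_eq_card_of_nodup hnd hmem
  match l, hnd, hmem, hadj, hF, hlen with
  | [], _, _, _, _, hlen => simp at hlen; omega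
  | a :: m, hnd, hmem, hadj, hF, hlen =>
    have hnext : ∀ i (hi : i + 1 < (a :: m ++ [a]).length),
        (a :: m).formPerm ((a :: m ++ [a])[i]) = (a :: m ++ [a])[i + 1] := by
      intro i hi
      simp only [List.length_append, List.length_cons, List.length_nil] at hi
      rw [List.getElem_append_left (by simp; omega), List.formPerm_apply_getElem _ hnd]
      by_cases h : i < m.length
      · rw [List.getElem_append_left (by simp; omega)]
        congr 1
        rw [List.length_cons, Nat.mod_eq_of_lt (by omega)]
      · rw [List.getElem_append_right (by simp; omega)]
        simp [show i = m.length by omega]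
    have hchain : (a :: m ++ [a]).IsChain H.Adj := by
      rw [List.isChain_iff_getElem]
      intro i hi
      rw [← hnext i hi]
      exact hadj _
    let q := Walk.ofSupport (a :: m ++ [a]) (by simp) hchain
    have hq : q.support = a :: m ++ [a] := Walk.support_ofSupport _ _
    have hlast : (a :: m ++ [a]).getLast (by simp) = a := by simp
    let p : H.Walk a a := q.copy rfl hlast
    have hp : p.support = a :: m ++ [a] := (Walk.support_copy q rfl hlast).trans hq
    have htail : p.support.tail = m ++ [a] := by rw [hp]; rfl
    have hnd' : (m ++ [a]).Nodup := by
      rw [List.nodup_append_comm]; exact hnd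
    have hplen : p.length = Fintype.card W := by
      have := p.length_support
      rw [hp] at this
      simp at this hlen
      omega
    have hnn : ¬ p.Nil := by
      rw [← Walk.length_eq_zero_iff]; omega
    refine ⟨a, p, ?_, ?_⟩
    · rw [Walk.isHamiltonianCycle_iff_isCycle_and_length_eq,
        Walk.isCycle_iff_isPath_tail_and_le_length, Walk.isPath_def,
        Walk.support_tail_of_not_nil _ hnn, htail]
      exact ⟨⟨hnd', by omega⟩, hplen⟩
    · intro e he
      obtain ⟨w, rfl⟩ := hF e he
      obtain ⟨i, hi, rfl⟩ := List.getElem_of_mem (hmem w)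
      rw [← Walk.infix_support_iff_mem_edges, hp]
      left
      have hi' : i + 1 < (a :: m ++ [a]).length := by simp at hi ⊢; omega
      have h1 : (a :: m)[i] = (a :: m ++ [a])[i] := by rw [List.getElem_append_left]
      rw [h1, hnext i hi']
      refine ⟨(a :: m ++ [a]).take i, (a :: m ++ [a]).drop (i + 2), ?_⟩
      have hd : (a :: m ++ [a]).drop i =
          [(a :: m ++ [a])[i], (a :: m ++ [a])[i + 1]] ++ (a :: m ++ [a]).drop (i + 2) := by
        rw [List.drop_eq_getElem_cons (by omega), List.drop_eq_getElem_cons hi']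
        rfl
      rw [List.append_assoc, ← hd, List.take_append_drop]

/-- A cyclic enumeration of the vertices with consecutive vertices adjacent. -/
theorem hasHamCycleThrough_of_enumeration {H : SimpleGraph W} {F : Set (Sym2 W)} {n : ℕ}
    (hn : Fintype.card W = n) (g : ℕ → W)
    (hinj : ∀ j < n, ∀ k < n, g j = g k → j = k)
    (hadj : ∀ k, k + 1 < n → H.Adj (g k) (g (k + 1))) (hclose : H.Adj (g (n - 1)) (g 0))
    (hF : ∀ e ∈ F, (∃ k, k + 1 < n ∧ e = s(g k, g (k + 1))) ∨ e = s(g (n - 1), g 0)) :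
    HasHamCycleThrough H F := by
  have hnd : ((List.range n).map g).Nodup := by
    rw [List.nodup_map_iff_inj_on List.nodup_range]
    intro j hj k hk h
    exact hinj j (List.mem_range.1 hj) k (List.mem_range.1 hk) h
  have hmem : ∀ w, w ∈ (List.range n).map g := by
    intro w
    have h1 : ((List.range n).map g).toFinset = univ := by
      rw [← Finset.card_eq_iff_eq_univ, List.toFinset_card_of_nodup hnd, hn]
      simp
    have := mem_univ w
    rw [← h1] at this
    simpa using this
  have hnext : ∀ k (hk : k < n), ((List.range n).map g).formPerm (g k) = g ((k + 1) % n) := by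
    intro k hk
    have := List.formPerm_apply_getElem _ hnd k (by simpa using hk)
    simpa using this
  refine ⟨(List.range n).map g, hnd, hmem, ?_, ?_⟩
  · intro w
    obtain ⟨k, hk, rfl⟩ := List.mem_map.1 (hmem w)
    rw [List.mem_range] at hk
    rw [hnext k hk]
    by_cases h : k + 1 < n
    · rw [Nat.mod_eq_of_lt h]
      exact hadj k h
    · obtain rfl : k = n - 1 := by omega
      rw [show n - 1 + 1 = n by omega, Nat.mod_self]
      exact hclose
  · intro e he
    rcases hF e he with ⟨k, hk, rfl⟩ | rfl
    · exact ⟨g k, by rw [hnext k (by omega), Nat.mod_eq_of_lt hk]⟩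
    · rcases Nat.eq_zero_or_pos n with rfl | hpos
      · exact absurd rfl (H.ne_of_adj hclose)
      · exact ⟨g (n - 1), by rw [hnext _ (by omega), show n - 1 + 1 = n by omega, Nat.mod_self]⟩

/-- A cyclic ordering can be enumerated such that any given vertex comes last. -/
theorem exists_enumeration {n : ℕ} (hn : Fintype.card W = n) {l : List W} (hnd : l.Nodup)
    (hmem : ∀ w, w ∈ l) (w₀ : W) :
    ∃ g : ℕ → W, (∀ j < n, ∀ k < n, g j = g k → j = k) ∧ (∀ w, ∃ k < n, g k = w) ∧
      (∀ k, l.formPerm (g k) = g (k + 1)) ∧ g (n - 1) = w₀ ∧ g n = g 0 := by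
  have hlen : l.length = n := (length_eq_card_of_nodup hnd hmem).trans hn
  have hpos : 0 < n := by rw [← hn]; exact Fintype.card_pos_iff.2 ⟨w₀⟩
  obtain ⟨j, hj, hj'⟩ := List.getElem_of_mem (hmem w₀)
  have hlt : ∀ k, (j + 1 + k) % n < l.length := fun k => by
    rw [hlen]; exact Nat.mod_lt _ hpos
  have hinj : ∀ k < n, ∀ k' < n, l[(j + 1 + k) % n]'(hlt k) = l[(j + 1 + k') % n]'(hlt k') →
      k = k' := by
    intro k hk k' hk' h
    have h1 := (hnd.getElem_inj_iff).1 h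
    have h2 : k ≡ k' [MOD n] := Nat.ModEq.add_left_cancel' (j + 1) h1
    exact h2.eq_of_lt_of_lt hk hk'
  refine ⟨fun k => l[(j + 1 + k) % n]'(hlt k), hinj, ?_, ?_, ?_, ?_⟩
  · intro w
    have h1 : (range n).image (fun k => l[(j + 1 + k) % n]'(hlt k)) = univ := by
      rw [← Finset.card_eq_iff_eq_univ, hn, Finset.card_image_of_injOn, card_range]
      intro a ha b hb h
      exact hinj a (by simpa using ha) b (by simpa using hb) h
    have := mem_univ w
    rw [← h1] at this
    simpa using this
  · intro k
    simp only [List.formPerm_apply_getElem _ hnd, hlen]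
    congr 1
    rw [Nat.mod_add_mod, add_assoc (j + 1)]
  · rw [← hj']
    simp only [show j + 1 + (n - 1) = j + n by omega, Nat.add_mod_right]
    congr 1
    exact Nat.mod_eq_of_lt (by omega)
  · simp

/-- The exchange argument of Ore and Bondy-Chvátal for a Hamilton path. -/
theorem hasHamCycleThrough_of_path {H : SimpleGraph W} {F : Set (Sym2 W)} {n : ℕ}
    (hn : Fintype.card W = n) (h2 : 2 ≤ n) (g : ℕ → W)
    (hinj : ∀ j < n, ∀ k < n, g j = g k → j = k) (hsurj : ∀ w, ∃ k < n, g k = w)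
    (hadj : ∀ k, k + 1 < n → H.Adj (g k) (g (k + 1)))
    (hF : ∀ e ∈ F, ∃ k, k + 1 < n ∧ e = s(g k, g (k + 1)))
    (hdeg : n + F.ncard ≤ (H.neighborSet (g 0)).ncard + (H.neighborSet (g (n - 1))).ncard) :
    HasHamCycleThrough H F := by
  let S : Finset ℕ := {k ∈ range (n - 1) | H.Adj (g 0) (g (k + 1))}
  let T : Finset ℕ := {k ∈ range (n - 1) | H.Adj (g (n - 1)) (g k)}
  let R : Finset ℕ := {k ∈ range (n - 1) | s(g k, g (k + 1)) ∈ F}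
  have hS : (H.neighborSet (g 0)).ncard ≤ #S := by
    rw [← Set.ncard_coe_finset]
    refine (Set.ncard_le_ncard (t := (fun k => g (k + 1)) '' (S : Set ℕ)) ?_).trans
      (Set.ncard_image_le S.finite_toSet)
    intro w hw
    obtain ⟨k, hk, rfl⟩ := hsurj w
    have hk0 : k ≠ 0 := fun h => H.ne_of_adj hw (by rw [h])
    obtain ⟨j, rfl⟩ : ∃ j, k = j + 1 := ⟨k - 1, by omega⟩
    exact ⟨j, by simpa [S] using ⟨by omega, hw⟩, rfl⟩
  have hT : (H.neighborSet (g (n - 1))).ncard ≤ #T := by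
    rw [← Set.ncard_coe_finset]
    refine (Set.ncard_le_ncard (t := g '' (T : Set ℕ)) ?_).trans
      (Set.ncard_image_le T.finite_toSet)
    intro w hw
    obtain ⟨k, hk, rfl⟩ := hsurj w
    have hk0 : k ≠ n - 1 := fun h => H.ne_of_adj hw (by rw [h])
    exact ⟨k, by simpa [T] using ⟨by omega, hw⟩, rfl⟩
  have hR : #R ≤ F.ncard := by
    rw [← Set.ncard_coe_finset]
    refine Set.ncard_le_ncard_of_injOn (fun k => s(g k, g (k + 1))) ?_ ?_
    · intro k hk
      have : k ∈ R := hk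
      exact (mem_filter.1 this).2
    · intro j hj k hk h
      have hj' : j < n - 1 := mem_range.1 (mem_filter.1 (show j ∈ R from hj)).1
      have hk' : k < n - 1 := mem_range.1 (mem_filter.1 (show k ∈ R from hk)).1
      rcases Sym2.eq_iff.1 h with ⟨h1, -⟩ | ⟨h1, h2⟩
      · exact hinj _ (by omega) _ (by omega) h1
      · have e1 := hinj _ (by omega) _ (by omega) h1
        have e2 := hinj _ (by omega) _ (by omega) h2
        omega
  have hST : n - 1 + #(S ∩ T) ≥ #S + #T := by
    rw [← Finset.card_union_add_card_inter]
    have : #(S ∪ T) ≤ #(range (n - 1)) :=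
      card_le_card (union_subset (filter_subset _ _) (filter_subset _ _))
    rw [card_range] at this
    omega
  -- `S` and `T` lie in a set of n - 1 indices and have total size at least n + |F|, so they share
  -- more than |F| indices; at one of them the path edge is not prescribed and may be cut.
  obtain ⟨i, hi, hiR⟩ := Finset.exists_mem_notMem_of_card_lt_card (show #R < #(S ∩ T) by omega)
  obtain ⟨hiS, hiT⟩ := mem_inter.1 hi
  obtain ⟨hin, hiS⟩ := mem_filter.1 hiS
  obtain ⟨-, hiT⟩ := mem_filter.1 hiT
  rw [mem_range] at hin
  have hiF : s(g i, g (i + 1)) ∉ F := fun h => hiR (mem_filter.2 ⟨mem_range.2 hin, h⟩)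
  -- The rerouted cycle: follow the path up to `g i`, jump to its last vertex, return backwards to
  -- `g (i + 1)`, and close up at `g 0`.
  let g' : ℕ → W := fun k => if k ≤ i then g k else g (n + i - k)
  have hlow : ∀ k, k ≤ i → g' k = g k := fun k hk => if_pos hk
  have hhigh : ∀ k, i < k → g' k = g (n + i - k) := fun k hk => if_neg (by omega)
  refine hasHamCycleThrough_of_enumeration hn g' ?_ ?_ ?_ ?_
  · intro j hj k hk h
    rcases le_or_gt j i with h1 | h1 <;> rcases le_or_gt k i with h2 | h2
    · rw [hlow j h1, hlow k h2] at h
      exact hinj _ hj _ hk h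
    · rw [hlow j h1, hhigh k h2] at h
      have := hinj _ hj _ (by omega) h
      omega
    · rw [hhigh j h1, hlow k h2] at h
      have := hinj _ (by omega) _ hk h
      omega
    · rw [hhigh j h1, hhigh k h2] at h
      have := hinj _ (by omega) _ (by omega) h
      omega
  · intro k hk
    rcases lt_trichotomy k i with h | h | h
    · rw [hlow k (by omega), hlow (k + 1) (by omega)]
      exact hadj k hk
    · subst h
      rw [hlow k le_rfl, hhigh (k + 1) (by omega), show n + k - (k + 1) = n - 1 by omega]
      exact hiT.symm
    · rw [hhigh k h, hhigh (k + 1) (by omega),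
        show n + i - k = n + i - (k + 1) + 1 by omega]
      exact (hadj _ (by omega)).symm
  · rw [hhigh (n - 1) (by omega), hlow 0 (by omega), show n + i - (n - 1) = i + 1 by omega]
    exact hiS.symm
  · intro e he
    obtain ⟨k, hk, rfl⟩ := hF e he
    rcases lt_trichotomy k i with h | h | h
    · exact Or.inl ⟨k, hk, by rw [hlow k (by omega), hlow (k + 1) (by omega)]⟩
    · exact absurd (h ▸ he) hiF
    · refine Or.inl ⟨n + i - (k + 1), by omega, ?_⟩
      rw [hhigh (n + i - (k + 1)) (by omega), hhigh (n + i - (k + 1) + 1) (by omega),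
        show n + i - (n + i - (k + 1)) = k + 1 by omega,
        show n + i - (n + i - (k + 1) + 1) = k by omega, Sym2.eq_swap]

/-- If the given cycle uses the new edge, removing that edge leaves a Hamilton path of H between u
and v. It still contains F, since the new edge is not prescribed, and the exchange argument closes
it. -/
theorem HasHamCycleThrough.of_sup_edge {H : SimpleGraph W} {F : Set (Sym2 W)} {u v : W}
    (h3 : 3 ≤ Fintype.card W) (hF : s(u, v) ∉ F)
    (hdeg : Fintype.card W + F.ncard ≤ (H.neighborSet u).ncard + (H.neighborSet v).ncard)
    (h : HasHamCycleThrough (H ⊔ edge u v) F) : HasHamCycleThrough H F := by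
  obtain ⟨l, hnd, hmem, hadj, hlF⟩ := h
  by_cases hall : ∀ w, H.Adj w (l.formPerm w)
  · exact ⟨l, hnd, hmem, hall, hlF⟩
  push Not at hall
  obtain ⟨w₀, hw₀⟩ := hall
  have hsup : ∀ a b, (H ⊔ edge u v).Adj a b → H.Adj a b ∨ s(a, b) = s(u, v) := by
    intro a b hab
    rw [sup_adj, edge_adj] at hab
    rcases hab with h | ⟨h, -⟩
    · exact Or.inl h
    · exact Or.inr (Sym2.eq_iff.2 (by tauto))
  have hw : s(w₀, l.formPerm w₀) = s(u, v) := (hsup _ _ (hadj w₀)).resolve_left hw₀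
  obtain ⟨g, hinj, hsurj, hnext, hlast, hper⟩ := exists_enumeration rfl hnd hmem w₀
  set n := Fintype.card W with hn
  have hfirst : l.formPerm w₀ = g 0 := by
    rw [← hlast, hnext, show n - 1 + 1 = n by omega, hper]
  rw [hfirst, ← hlast] at hw
  refine hasHamCycleThrough_of_path hn.symm (by omega) g hinj hsurj ?_ ?_ ?_
  · intro k hk
    have h1 := hadj (g k)
    rw [hnext] at h1
    refine (hsup _ _ h1).resolve_right fun h2 => ?_
    rw [← hw] at h2
    rcases Sym2.eq_iff.1 h2 with ⟨h4, -⟩ | ⟨h4, h5⟩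
    · have := hinj _ (by omega) _ (by omega) h4
      omega
    · have := hinj _ (by omega) _ (by omega) h4
      have := hinj _ (by omega) _ (by omega) h5
      omega
  · intro e he
    obtain ⟨w, rfl⟩ := hlF e he
    obtain ⟨k, hk, rfl⟩ := hsurj w
    rw [hnext] at he ⊢
    refine ⟨k, ?_, rfl⟩
    by_contra hk'
    obtain rfl : k = n - 1 := by omega
    rw [show n - 1 + 1 = n by omega, hper, hw] at he
    exact hF he
  · rcases Sym2.eq_iff.1 hw with ⟨h4, h5⟩ | ⟨h4, h5⟩
    · rw [h4, h5]; omega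
    · rw [h4, h5]; omega

end HamiltonLists

/-! ### Linear forests and their extension to Hamilton cycles. -/

section LinearForests

open SimpleGraph Classical

theorem pair_infix_append_iff {α : Type*} {a b : List α} {x y : α} :
    [x, y] <:+: a ++ b ↔ [x, y] <:+: a ∨ [x, y] <:+: b ∨ (a.getLast? = some x ∧ b.head? = some y) := by
  constructor
  · rintro ⟨s, t, h⟩
    have h' : s ++ (x :: y :: t) = a ++ b := by simpa using h
    rcases List.append_eq_append_iff.1 h' with ⟨c, rfl, hc⟩ | ⟨c, rfl, hc⟩
    · match c, hc with
      | [], hc => right; left; exact ⟨[], t, by simpa using hc⟩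
      | [z], hc =>
        simp only [List.cons_append, List.nil_append, List.cons.injEq] at hc
        obtain ⟨rfl, hc⟩ := hc
        right; right; simp [← hc]
      | z :: w :: c, hc =>
        simp only [List.cons_append, List.cons.injEq] at hc
        obtain ⟨rfl, rfl, hc⟩ := hc
        left; exact ⟨s, c, by simp⟩
    · right; left
      exact ⟨c, t, by simp [hc]⟩
  · rintro (h | h | ⟨h1, h2⟩)
    · exact h.trans (List.prefix_append a b).isInfix
    · exact h.trans (List.suffix_append a b).isInfix
    · obtain ⟨c, rfl⟩ := List.getLast?_eq_some_iff.1 h1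
      obtain ⟨d, rfl⟩ := List.head?_eq_some_iff.1 h2
      exact ⟨c, d, by simp⟩

theorem pair_infix_cons_iff {α : Type*} {b : List α} {c x y : α} :
    [x, y] <:+: c :: b ↔ (c = x ∧ b.head? = some y) ∨ [x, y] <:+: b := by
  rw [show c :: b = [c] ++ b from rfl, pair_infix_append_iff]
  constructor
  · rintro (h | h | ⟨h1, h2⟩)
    · have := h.length_le; simp at this
    · exact Or.inr h
    · exact Or.inl ⟨by simpa using h1, h2⟩
  · rintro (⟨rfl, h⟩ | h)
    · exact Or.inr (Or.inr ⟨rfl, h⟩)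
    · exact Or.inr (Or.inl h)

variable {V : Type*}

/-- A finite acyclic graph with an edge has a leaf. -/
theorem exists_leaf [Fintype V] {F : SimpleGraph V} (hF : F.IsAcyclic) {a b : V} (hab : F.Adj a b) :
    ∃ u x, F.Adj u x ∧ ∀ w, F.Adj u w → w = x := by
  have : Nonempty V := ⟨a⟩
  obtain ⟨u, v, p, hp, hmax⟩ := Walk.exists_isPath_forall_isPath_length_le_length F
  have hnil : ¬ p.Nil := by
    intro h
    have h1 := hmax a b hab.toWalk (by simp [Walk.isPath_def, hab.ne])
    rw [Walk.length_eq_zero_iff.2 h] at h1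
    simp at h1
  refine ⟨u, p.snd, p.adj_snd hnil, fun w hadj => ?_⟩
  -- In a forest, a neighbour of the path's start that lies on the path is its second vertex; a
  -- neighbour off the path would prolong a longest path.
  apply hF.eq_snd_of_adj_start hp hadj
  by_contra hw
  have := hmax _ _ _ (hp.cons hw (h := hadj.symm))
  simp at this

/-- The vertices can be ordered such that the edges of a given linear forest join consecutive
vertices. -/
theorem IsLinearForest.exists_list [Fintype V] {F : SimpleGraph V} (hF : IsLinearForest F) :
    ∃ l : List V, l.Nodup ∧ (∀ w, w ∈ l) ∧
      ∀ x y, F.Adj x y → [x, y] <:+: l ∨ [y, x] <:+: l := by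
  induction hm : F.edgeSet.ncard using Nat.strong_induction_on generalizing F with
  | _ m ih =>
  subst hm
  by_cases hempty : ∃ a b, F.Adj a b
  swap
  · push Not at hempty
    exact ⟨univ.toList, nodup_toList _, by simp, fun x y h => absurd h (hempty x y)⟩
  obtain ⟨a, b, hab⟩ := hempty
  obtain ⟨u, x, hux, huniq⟩ := exists_leaf hF.1 hab
  set F' := F.deleteEdges {s(u, x)} with hF'
  have hle : F' ≤ F := deleteEdges_le _
  have hadj : ∀ {c d}, F'.Adj c d → F.Adj c d ∧ c ≠ u ∧ d ≠ u := by
    intro c d h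
    rw [hF', deleteEdges_adj] at h
    refine ⟨h.1, ?_, ?_⟩
    · rintro rfl
      exact h.2 (by rw [huniq d h.1]; rfl)
    · rintro rfl
      exact h.2 (by rw [huniq c h.1.symm, Sym2.eq_swap]; rfl)
  have hadj' : ∀ c d, F.Adj c d → F'.Adj c d ∨ (c = u ∧ d = x) ∨ (c = x ∧ d = u) := by
    intro c d h
    by_cases h' : s(c, d) = s(u, x)
    · exact Or.inr (Sym2.eq_iff.1 h')
    · left
      rw [hF', deleteEdges_adj]
      exact ⟨h, h'⟩
  have hlin : IsLinearForest F' :=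
    ⟨hF.1.anti hle, fun v => (Set.ncard_le_ncard fun w hw => hle hw).trans (hF.2 v)⟩
  have hlt : F'.edgeSet.ncard < F.edgeSet.ncard := by
    apply Set.ncard_lt_ncard _ (Set.toFinite _)
    refine ⟨edgeSet_mono hle, fun h => ?_⟩
    have : F'.Adj u x := h (show s(u, x) ∈ F.edgeSet from hux)
    exact (hadj this).2.1 rfl
  obtain ⟨l, hnd, hmem, hl⟩ := ih _ hlt hlin rfl
  -- The leaf u is isolated in `F'`, so it can be taken out of the ordering without separating an
  -- edge, and put back beside x.
  obtain ⟨l₁, l₂, rfl⟩ := List.append_of_mem (hmem u)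
  have hnd' : (u :: (l₁ ++ l₂)).Nodup := (List.nodup_middle).1 hnd
  have hmem' : ∀ w, w ≠ u → w ∈ l₁ ++ l₂ := by
    intro w hw
    have := hmem w
    simp only [List.mem_append, List.mem_cons] at this ⊢
    tauto
  have hL : ∀ c d, F'.Adj c d → [c, d] <:+: l₁ ++ l₂ ∨ [d, c] <:+: l₁ ++ l₂ := by
    intro c d h
    have h1 : ∀ c d, c ≠ u → d ≠ u → [c, d] <:+: l₁ ++ u :: l₂ → [c, d] <:+: l₁ ++ l₂ := by
      intro c d hc hd h
      rw [pair_infix_append_iff, pair_infix_cons_iff] at h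
      rw [pair_infix_append_iff]
      rcases h with h | (⟨h, -⟩ | h) | ⟨-, h⟩
      · exact Or.inl h
      · exact absurd h.symm hc
      · exact Or.inr (Or.inl h)
      · simp only [List.head?_cons, Option.some.injEq] at h
        exact absurd h.symm hd
    obtain ⟨-, hc, hd⟩ := hadj h
    exact (hl c d h).imp (h1 c d hc hd) (h1 d c hd hc)
  obtain ⟨m₁, m₂, hm⟩ := List.append_of_mem (hmem' x hux.ne')
  rw [hm] at hL hnd' hmem'
  -- Insert u directly after x unless this breaks an edge of `F'`, otherwise directly before x. If
  -- both sides are blocked, x has three neighbours in F.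
  by_cases hA : ∀ y, m₂.head? = some y → ¬ F'.Adj x y
  · have h1 : ∀ c d, F'.Adj c d → [c, d] <:+: m₁ ++ x :: m₂ → [c, d] <:+: m₁ ++ x :: u :: m₂ := by
      intro c d hcd h
      simp only [pair_infix_append_iff, pair_infix_cons_iff, List.head?_cons] at h ⊢
      rcases h with h | (⟨rfl, h⟩ | h) | h
      · tauto
      · exact absurd hcd (hA _ h)
      · tauto
      · tauto
    have hux' : [x, u] <:+: m₁ ++ x :: u :: m₂ := ⟨m₁, m₂, by simp⟩
    refine ⟨m₁ ++ x :: u :: m₂, ?_, ?_, ?_⟩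
    · have : (m₁ ++ x :: u :: m₂).Perm (u :: (m₁ ++ x :: m₂)) := by
        have := (List.perm_middle (a := u) (l₁ := m₁ ++ [x]) (l₂ := m₂))
        simpa using this
      exact this.nodup_iff.2 hnd'
    · intro w
      by_cases hw : w = u
      · simp [hw]
      · have := hmem' w hw
        simp only [List.mem_append, List.mem_cons] at this ⊢
        tauto
    · intro c d hcd
      rcases hadj' c d hcd with h | ⟨rfl, rfl⟩ | ⟨rfl, rfl⟩
      · exact (hL c d h).imp (h1 c d h) (h1 d c h.symm)
      · exact Or.inr hux'
      · exact Or.inl hux'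
  by_cases hB : ∀ y, m₁.getLast? = some y → ¬ F'.Adj x y
  · have h1 : ∀ c d, F'.Adj c d → [c, d] <:+: m₁ ++ x :: m₂ → [c, d] <:+: m₁ ++ u :: x :: m₂ := by
      intro c d hcd h
      simp only [pair_infix_append_iff, pair_infix_cons_iff, List.head?_cons,
        Option.some.injEq] at h ⊢
      rcases h with h | (⟨rfl, h⟩ | h) | ⟨h, rfl⟩
      · tauto
      · tauto
      · tauto
      · exact absurd hcd.symm (hB _ h)
    have hux' : [u, x] <:+: m₁ ++ u :: x :: m₂ := ⟨m₁, m₂, by simp⟩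
    refine ⟨m₁ ++ u :: x :: m₂, ?_, ?_, ?_⟩
    · exact (List.perm_middle (a := u) (l₁ := m₁) (l₂ := x :: m₂)).nodup_iff.2 hnd'
    · intro w
      by_cases hw : w = u
      · simp [hw]
      · have := hmem' w hw
        simp only [List.mem_append, List.mem_cons] at this ⊢
        tauto
    · intro c d hcd
      rcases hadj' c d hcd with h | ⟨rfl, rfl⟩ | ⟨rfl, rfl⟩
      · exact (hL c d h).imp (h1 c d h) (h1 d c h.symm)
      · exact Or.inl hux'
      · exact Or.inr hux'
  push Not at hA hB
  obtain ⟨y, hy, hxy⟩ := hA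
  obtain ⟨z, hz, hxz⟩ := hB
  exfalso
  have hyz : y ≠ z := by
    rintro rfl
    have h1 := List.mem_of_mem_head? hy
    have h2 := List.mem_of_mem_getLast? hz
    have h3 := (List.nodup_cons.1 hnd').2
    rw [List.nodup_append] at h3
    exact h3.2.2 _ h2 _ (List.mem_cons_of_mem _ h1) rfl
  have h3 : ({u, y, z} : Set V) ⊆ F.neighborSet x := by
    rintro w (rfl | rfl | rfl)
    · exact hux.symm
    · exact (hadj hxy).1
    · exact (hadj hxz).1
  have h4 := (Set.ncard_le_ncard h3).trans (hF.2 x)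
  rw [Set.ncard_eq_three.2 ⟨u, y, z, (hadj hxy).2.2.symm, (hadj hxz).2.2.symm, hyz, rfl⟩] at h4
  omega

/-- Every linear forest on at least three vertices extends to a Hamilton cycle of the complete
graph. -/
theorem IsLinearForest.hasHamCycleThrough_top [Fintype V] {F : SimpleGraph V} (hF : IsLinearForest F)
    (h3 : 3 ≤ Fintype.card V) : HasHamCycleThrough (⊤ : SimpleGraph V) F.edgeSet := by
  obtain ⟨l, hnd, hmem, hl⟩ := hF.exists_list
  have hlen := length_eq_card_of_nodup hnd hmem
  obtain ⟨v₀⟩ : Nonempty V := Fintype.card_pos_iff.1 (by omega)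
  have hget : ∀ k (hk : k < l.length), l.getD k v₀ = l[k] := fun k hk => by
    simp [hk]
  have hinj : ∀ j < Fintype.card V, ∀ k < Fintype.card V,
      l.getD j v₀ = l.getD k v₀ → j = k := by
    intro j hj k hk h
    rw [hget j (by omega), hget k (by omega)] at h
    exact hnd.getElem_inj_iff.1 h
  have hedge : ∀ x y, [x, y] <:+: l →
      ∃ k, k + 1 < Fintype.card V ∧ s(x, y) = s(l.getD k v₀, l.getD (k + 1) v₀) := by
    rintro x y ⟨a, b, h⟩
    have h' : l = a ++ x :: y :: b := by simpa using h.symm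
    subst h'
    refine ⟨a.length, ?_, ?_⟩
    · rw [← hlen]; simp
    · rw [hget _ (by simp), hget _ (by simp)]
      simp
  refine hasHamCycleThrough_of_enumeration rfl (fun k => l.getD k v₀) hinj ?_ ?_ ?_
  · intro k hk h
    have := hinj _ (by omega) _ hk h
    omega
  · intro h
    have := hinj _ (by omega) _ (by omega) h
    omega
  · intro e he
    left
    induction e with
    | _ x y =>
      rcases hl x y he with h | h
      · exact hedge x y h
      · rw [Sym2.eq_swap]
        exact hedge y x h

/-- The path with the edges `f 0 f 1, …, f (k - 1) f k`. -/
def pathThrough (f : ℕ → V) (k : ℕ) : SimpleGraph V :=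
  fromEdgeSet {e | ∃ j < k, e = s(f j, f (j + 1))}

theorem pathThrough_succ (f : ℕ → V) (k : ℕ) :
    pathThrough f (k + 1) = pathThrough f k ⊔ edge (f k) (f (k + 1)) := by
  ext x y
  simp only [pathThrough, sup_adj, fromEdgeSet_adj, Set.mem_ofPred_eq, edge_adj,
    Nat.lt_succ_iff_lt_or_eq]
  constructor
  · rintro ⟨⟨j, hj | rfl, h⟩, hne⟩
    · exact Or.inl ⟨⟨j, hj, h⟩, hne⟩
    · exact Or.inr ⟨Sym2.eq_iff.1 h, hne⟩
  · rintro (⟨⟨j, hj, h⟩, hne⟩ | ⟨h, hne⟩)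
    · exact ⟨⟨j, Or.inl hj, h⟩, hne⟩
    · exact ⟨⟨k, Or.inr rfl, Sym2.eq_iff.2 h⟩, hne⟩

theorem isAcyclic_pathThrough {f : ℕ → V} {k : ℕ} (hf : Set.InjOn f (Set.Iic k)) :
    (pathThrough f k).IsAcyclic := by
  induction k with
  | zero =>
    have : pathThrough f 0 = ⊥ := by
      ext x y
      simp [pathThrough]
    rw [this]
    exact isAcyclic_bot
  | succ k ih =>
    rw [pathThrough_succ]
    refine (ih (hf.mono (Set.Iic_subset_Iic.2 k.le_succ))).sup_edge_of_not_reachable ?_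
    rintro ⟨p⟩
    have hne : f (k + 1) ≠ f k := fun h => by
      have := hf (by simp) (by simp) h
      omega
    -- The new endpoint `f (k + 1)` meets no earlier edge, so no walk can leave it.
    have hp : ¬ p.reverse.Nil := fun h => hne h.eq
    have hadj := p.reverse.adj_snd hp
    obtain ⟨⟨j, hj, h⟩, -⟩ := (fromEdgeSet_adj _).1 hadj
    rcases Sym2.eq_iff.1 h with ⟨h, -⟩ | ⟨h, -⟩
    · have := hf (by simp) (by simp; omega) h
      omega
    · have := hf (by simp) (by simp; omega) h
      omega

theorem isLinearForest_pathThrough [Fintype V] {f : ℕ → V} {k : ℕ} (hf : Set.InjOn f (Set.Iic k)) :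
    IsLinearForest (pathThrough f k) := by
  refine ⟨isAcyclic_pathThrough hf, fun v => ?_⟩
  by_cases hv : ∃ i ≤ k, f i = v
  · obtain ⟨i, hi, rfl⟩ := hv
    refine (Set.ncard_le_ncard (t := {f (i - 1), f (i + 1)}) ?_).trans
      ((Set.ncard_insert_le _ _).trans (by simp))
    intro w hw
    have hw : (pathThrough f k).Adj (f i) w := hw
    rw [pathThrough, fromEdgeSet_adj] at hw
    obtain ⟨⟨j, hj, h⟩, -⟩ := hw
    rcases Sym2.eq_iff.1 h with ⟨h, h'⟩ | ⟨h, h'⟩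
    · have := hf hi (by simp; omega) h
      subst this
      right
      exact h'
    · have := hf hi (by simp; omega) h
      subst this
      left
      simpa using h'
  · refine (Set.ncard_le_ncard (t := ∅) ?_).trans (by simp)
    intro w hw
    have hw : (pathThrough f k).Adj v w := hw
    rw [pathThrough, fromEdgeSet_adj] at hw
    obtain ⟨⟨j, hj, h⟩, -⟩ := hw
    refine hv ?_
    rcases Sym2.eq_iff.1 h with ⟨h, h'⟩ | ⟨h, h'⟩
    · exact ⟨j, hj.le, h.symm⟩
    · exact ⟨j + 1, hj, h.symm⟩

theorem edgeSet_pathThrough {f : ℕ → V} {k : ℕ} (hf : Set.InjOn f (Set.Iic k)) :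
    (pathThrough f k).edgeSet = (fun j => s(f j, f (j + 1))) '' Set.Iio k := by
  ext e
  simp only [pathThrough, edgeSet_fromEdgeSet, Set.mem_sdiff, Set.mem_ofPred_eq, Set.mem_image,
    Set.mem_Iio]
  constructor
  · rintro ⟨⟨j, hj, rfl⟩, -⟩
    exact ⟨j, hj, rfl⟩
  · rintro ⟨j, hj, rfl⟩
    refine ⟨⟨j, hj, rfl⟩, fun h => ?_⟩
    have h : f j = f (j + 1) := h
    have := hf (by simp; omega) (by simp; omega) h
    omega

theorem ncard_edgeSet_pathThrough {f : ℕ → V} {k : ℕ} (hf : Set.InjOn f (Set.Iic k)) :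
    (pathThrough f k).edgeSet.ncard = k := by
  rw [edgeSet_pathThrough hf, Set.InjOn.ncard_image]
  · rw [← Finset.coe_Iio, Set.ncard_coe_finset, Nat.card_Iio]
  · intro i hi j hj h
    have hi : i < k := hi
    have hj : j < k := hj
    rcases Sym2.eq_iff.1 h with ⟨h, -⟩ | ⟨h, h'⟩
    · exact hf (by simp; omega) (by simp; omega) h
    · have h1 := hf (by simp; omega) (by simp; omega) h
      have h2 := hf (by simp; omega) (by simp; omega) h'
      omega

end LinearForests

/-! ### The properties in terms of Hamilton cycles through prescribed edges. -/

section Characterizations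

open SimpleGraph Classical

variable {V : Type*} [Fintype V]

theorem HasHamCycleThrough.mono {W : Type*} {H H' : SimpleGraph W} {F : Set (Sym2 W)}
    (h : HasHamCycleThrough H F) (hle : H ≤ H') : HasHamCycleThrough H' F := by
  obtain ⟨l, h1, h2, h3, h4⟩ := h
  exact ⟨l, h1, h2, fun w => hle (h3 w), h4⟩

/-- An enumeration of the vertices with consecutive vertices adjacent is a Hamilton path. -/
theorem exists_isHamiltonian_of_enumeration {G : SimpleGraph V} {n : ℕ} (hn : Fintype.card V = n)
    (hpos : 0 < n) (g : ℕ → V) (hinj : ∀ j < n, ∀ k < n, g j = g k → j = k)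
    (hadj : ∀ k, k + 1 < n → G.Adj (g k) (g (k + 1))) :
    ∃ p : G.Walk (g 0) (g (n - 1)), p.IsHamiltonian := by
  have hnd : ((List.range n).map g).Nodup := by
    rw [List.nodup_map_iff_inj_on List.nodup_range]
    intro j hj k hk h
    exact hinj j (List.mem_range.1 hj) k (List.mem_range.1 hk) h
  have hne : (List.range n).map g ≠ [] := by simp; omega
  have hchain : ((List.range n).map g).IsChain G.Adj := by
    rw [List.isChain_iff_getElem]
    intro i hi
    simpa using hadj i (by simpa using hi)
  have hhead : ((List.range n).map g).head hne = g 0 := by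
    rw [List.head_eq_getElem]; simp
  have hlast : ((List.range n).map g).getLast hne = g (n - 1) := by
    rw [List.getLast_eq_getElem]; simp
  let q : G.Walk (g 0) (g (n - 1)) := (Walk.ofSupport _ hne hchain).copy hhead hlast
  have hq : q.support = (List.range n).map g :=
    (Walk.support_copy _ hhead hlast).trans (Walk.support_ofSupport _ _)
  have hlen : q.length = Fintype.card V - 1 := by
    have := q.length_support
    rw [hq, List.length_map, List.length_range] at this
    omega
  refine ⟨q, Walk.isHamiltonian_iff_isPath_and_length_eq.2 ⟨?_, hlen⟩⟩
  rw [Walk.isPath_def, hq]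
  exact hnd

/-- A Hamilton cycle through a prescribed edge yields a Hamilton path between its ends which does
not use the edge. -/
theorem exists_path_enumeration {G : SimpleGraph V} {u v : V} {n : ℕ} (hn : Fintype.card V = n)
    (h3 : 3 ≤ n) (h : HasHamCycleThrough (G ⊔ edge u v) {s(u, v)}) :
    ∃ g : ℕ → V, (∀ j < n, ∀ k < n, g j = g k → j = k) ∧
      (∀ k, k + 1 < n → G.Adj (g k) (g (k + 1))) ∧ s(g 0, g (n - 1)) = s(u, v) := by
  obtain ⟨l, hnd, hmem, hadj, hF⟩ := h
  obtain ⟨w, hw⟩ := hF _ rfl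
  obtain ⟨g, hinj, -, hnext, hlast, hper⟩ := exists_enumeration hn hnd hmem w
  have hfirst : l.formPerm w = g 0 := by
    rw [← hlast, hnext, show n - 1 + 1 = n by omega, hper]
  rw [hfirst, ← hlast] at hw
  refine ⟨g, hinj, ?_, by rw [hw, Sym2.eq_swap]⟩
  intro k hk
  have h1 := hadj (g k)
  rw [hnext, sup_adj, edge_adj] at h1
  rcases h1 with h1 | ⟨h1, -⟩
  · exact h1
  have h2 : s(g k, g (k + 1)) = s(u, v) := Sym2.eq_iff.2 h1
  rw [hw] at h2
  exfalso
  rcases Sym2.eq_iff.1 h2 with ⟨h4, -⟩ | ⟨h4, h5⟩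
  · have := hinj _ (by omega) _ (by omega) h4
    omega
  · have := hinj _ (by omega) _ (by omega) h4
    have := hinj _ (by omega) _ (by omega) h5
    omega

/-- The size condition excludes the one-vertex graph, Hamiltonian by convention, and the degenerate
cyclic ordering of two vertices. -/
theorem isHamiltonian_iff_hasHamCycleThrough {W : Type*} [Fintype W] [inst : DecidableEq W]
    {H : SimpleGraph W} (h3 : 3 ≤ Fintype.card W) :
    H.IsHamiltonian ↔ HasHamCycleThrough H ∅ := by
  obtain rfl : inst = fun a b => propDecidable _ := Subsingleton.elim _ _
  constructor
  · intro h
    obtain ⟨a, p, hp⟩ := h (by omega)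
    exact hasHamCycleThrough_of_walk p hp (by simp)
  · intro h _
    obtain ⟨a, p, hp, -⟩ := exists_walk_of_hasHamCycleThrough h3 h
    exact ⟨a, p, hp⟩

theorem isEdgeHamiltonian_iff {G : SimpleGraph V} {k : ℕ} (h3 : 3 ≤ Fintype.card V) :
    IsEdgeHamiltonian k G ↔ ∀ F : SimpleGraph V, F ≤ G → IsLinearForest F →
      F.edgeSet.ncard ≤ k → HasHamCycleThrough G F.edgeSet := by
  constructor
  · intro h F h1 h2 h4
    obtain ⟨a, p, hp, hF⟩ := h F h1 h2 h4
    exact hasHamCycleThrough_of_walk p hp hF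
  · intro h F h1 h2 h4
    exact exists_walk_of_hasHamCycleThrough h3 (h F h1 h2 h4)

/-- A Hamilton path from u to v is a Hamilton cycle through uv with that edge removed. Adding uv to
G makes this work whether or not u and v are adjacent. -/
theorem isHamiltonianConnected_iff {G : SimpleGraph V} (h3 : 3 ≤ Fintype.card V) :
    IsHamiltonianConnected G ↔
      ∀ u v : V, u ≠ v → HasHamCycleThrough (G ⊔ edge u v) {s(u, v)} := by
  constructor
  · intro h u v huv
    obtain ⟨p, hp⟩ := h u v huv
    have hlen := hp.length_eq
    have hend : p.getVert (Fintype.card V - 1) = v := by rw [← hlen]; simp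
    refine hasHamCycleThrough_of_enumeration rfl p.getVert ?_ ?_ ?_ ?_
    · intro j hj k hk hjk
      exact hp.isPath.getVert_injOn (show j ≤ p.length by omega) (show k ≤ p.length by omega) hjk
    · intro k hk
      exact Or.inl (p.adj_getVert_succ (by omega))
    · rw [hend, Walk.getVert_zero]
      exact Or.inr (by simp [edge_adj, huv.symm])
    · rintro e rfl
      right
      rw [hend, Walk.getVert_zero, Sym2.eq_swap]
  · intro h u v huv
    obtain ⟨g, hinj, hadj, hends⟩ := exists_path_enumeration rfl h3 (h u v huv)
    obtain ⟨p, hp⟩ := exists_isHamiltonian_of_enumeration rfl (by omega) g hinj hadj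
    rcases Sym2.eq_iff.1 hends with ⟨rfl, rfl⟩ | ⟨rfl, rfl⟩
    · exact ⟨p, hp⟩
    · refine ⟨p.reverse, fun a => ?_⟩
      rw [Walk.support_reverse, List.count_reverse]
      exact hp a

/-- The graph `G` with a further vertex joined to all the others. -/
def cone {V : Type*} (G : SimpleGraph V) : SimpleGraph (Option V) where
  Adj x y := x ≠ y ∧ ∀ a b, x = some a → y = some b → G.Adj a b
  symm := ⟨fun _ _ h => ⟨h.1.symm, fun a b ha hb => (h.2 b a hb ha).symm⟩⟩
  loopless := ⟨fun _ h => h.1 rfl⟩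

theorem cone_adj_some {V : Type*} {G : SimpleGraph V} {a b : V} :
    (cone G).Adj (some a) (some b) ↔ G.Adj a b := by
  constructor
  · intro h
    exact h.2 a b rfl rfl
  · intro h
    refine ⟨fun h' => h.ne (Option.some.inj h'), ?_⟩
    rintro c d hc hd
    rwa [← Option.some.inj hc, ← Option.some.inj hd]

theorem cone_adj_none {V : Type*} {G : SimpleGraph V} {a : V} :
    (cone G).Adj none (some a) :=
  ⟨by simp, fun _ _ h => by simp at h⟩

theorem ncard_neighborSet_cone {G : SimpleGraph V} (a : V) :
    ((cone G).neighborSet (some a)).ncard = (G.neighborSet a).ncard + 1 := by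
  have : (cone G).neighborSet (some a) = insert none (some '' G.neighborSet a) := by
    ext w
    rcases w with _ | w
    · simpa using cone_adj_none.symm
    · simpa using cone_adj_some
  rw [this, Set.ncard_insert_of_notMem (by simp),
    Set.ncard_image_of_injective _ (Option.some_injective V)]

/-- Cutting a Hamilton cycle of the cone at the apex gives a Hamilton path of G, and conversely the
apex joins the two ends of such a path. -/
theorem isTraceable_iff {G : SimpleGraph V} (h2 : 2 ≤ Fintype.card V) :
    IsTraceable G ↔ HasHamCycleThrough (cone G) ∅ := by
  have hcard : Fintype.card (Option V) = Fintype.card V + 1 := Fintype.card_option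
  set n := Fintype.card V with hn
  constructor
  · rintro ⟨u, v, p, hp⟩
    have hlen := hp.length_eq
    rw [← hn] at hlen
    let g : ℕ → Option V := fun k => if k < n then some (p.getVert k) else none
    have hg : ∀ k < n, g k = some (p.getVert k) := fun k hk => if_pos hk
    have hg' : g n = none := if_neg (lt_irrefl _)
    refine hasHamCycleThrough_of_enumeration hcard g ?_ ?_ ?_ (by simp)
    · intro j hj k hk hjk
      rcases (Nat.lt_succ_iff_lt_or_eq.1 hj) with h | rfl <;>
        rcases (Nat.lt_succ_iff_lt_or_eq.1 hk) with h' | rfl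
      · rw [hg _ h, hg _ h'] at hjk
        exact hp.isPath.getVert_injOn (show j ≤ p.length by omega)
          (show k ≤ p.length by omega) (Option.some.inj hjk)
      · rw [hg _ h, hg'] at hjk
        simp at hjk
      · rw [hg _ h', hg'] at hjk
        simp at hjk
      · rfl
    · intro k hk
      rcases (Nat.lt_succ_iff_lt_or_eq.1 hk) with h | h
      · rw [hg _ (by omega), hg _ h, cone_adj_some]
        exact p.adj_getVert_succ (by omega)
      · rw [h, hg', hg _ (by omega)]
        exact cone_adj_none.symm
    · rw [Nat.add_sub_cancel, hg', hg 0 (by omega)]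
      exact cone_adj_none
  · rintro ⟨l, hnd, hmem, hadj, -⟩
    obtain ⟨g, hinj, -, hnext, hlast, -⟩ := exists_enumeration hcard hnd hmem none
    rw [Nat.add_sub_cancel] at hlast
    have hsome : ∀ k, ∃ a : V, k < n → g k = some a := by
      intro k
      by_cases hk : k < n
      · rcases hgk : g k with _ | a
        · have := hinj k (by omega) n (by omega) (hgk.trans hlast.symm)
          omega
        · exact ⟨a, fun _ => rfl⟩
      · obtain ⟨a⟩ : Nonempty V := Fintype.card_pos_iff.1 (by omega)
        exact ⟨a, fun h => absurd h hk⟩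
    choose f hf using hsome
    obtain ⟨p, hp⟩ := exists_isHamiltonian_of_enumeration (G := G) hn.symm (by omega) f
      (by
        intro j hj k hk h
        refine hinj j (by omega) k (by omega) ?_
        rw [hf j hj, hf k hk, h])
      (by
        intro k hk
        have := hadj (g k)
        rw [hnext, hf k (by omega), hf (k + 1) hk] at this
        exact cone_adj_some.1 this)
    exact ⟨_, _, p, hp⟩

end Characterizations

/-! ### Stability of the properties under deletion of an edge. -/

section Stability

open SimpleGraph Classical

variable {V : Type*} [Fintype V]

theorem card_subtype_notMem (S : Finset V) [Fintype {v : V | v ∉ S}] :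
    Fintype.card {v : V | v ∉ S} + #S = Fintype.card V := by
  rw [← Set.toFinset_card]
  have : ({v : V | v ∉ S}).toFinset = Sᶜ := by ext; simp
  rw [this, Finset.card_compl]
  have := Finset.card_le_univ S
  omega

theorem ncard_neighborSet_induce_ge (G : SimpleGraph V) (S : Finset V) (u : {v : V | v ∉ S}) :
    (G.neighborSet u).ncard ≤ ((G.induce {v : V | v ∉ S}).neighborSet u).ncard + #S := by
  rw [← Set.ncard_coe_finset S, ← Set.ncard_image_of_injective _ Subtype.val_injective]
  refine (Set.ncard_le_ncard ?_).trans (Set.ncard_union_le _ _)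
  intro w hw
  by_cases h : w ∈ S
  · exact Or.inr h
  · exact Or.inl ⟨⟨w, h⟩, hw, rfl⟩

/-- All the properties are stable: an edge between vertices of large degree sum may be deleted. -/
theorem HamProperty.holds_of_sup_edge (P : HamProperty)
    (hℓ : P.ell ≤ (Fintype.card V : ℤ) - 3) {G : SimpleGraph V} {u v : V}
    (hnadj : ¬ G.Adj u v)
    (hdeg : (Fintype.card V : ℤ) + P.ell ≤ (G.neighborSet u).ncard + (G.neighborSet v).ncard)
    (h : P.Holds (G ⊔ edge u v)) : P.Holds G := by
  cases P with
  | hamiltonian =>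
    simp only [HamProperty.ell] at hℓ hdeg
    simp only [HamProperty.Holds] at h ⊢
    rw [isHamiltonian_iff_hasHamCycleThrough (by omega)] at h ⊢
    exact h.of_sup_edge (by omega) (by simp) (by simp; omega)
  | traceable =>
    simp only [HamProperty.ell] at hℓ hdeg
    simp only [HamProperty.Holds] at h ⊢
    rw [isTraceable_iff (by omega)] at h ⊢
    have hle : cone (G ⊔ edge u v) ≤ cone G ⊔ edge (some u) (some v) := by
      intro x y hxy
      by_cases hG : (cone G).Adj x y
      · exact Or.inl hG
      · right
        rcases x with _ | x <;> rcases y with _ | y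
        · exact absurd rfl hxy.1
        · exact absurd cone_adj_none hG
        · exact absurd cone_adj_none.symm hG
        · rw [cone_adj_some] at hxy hG
          have := hxy.resolve_left hG
          rw [edge_adj] at this ⊢
          simpa using this
    refine (h.mono hle).of_sup_edge ?_ (by simp) ?_
    · rw [Fintype.card_option]; omega
    -- The apex raises the degree sum by two and the order by one, which makes up for ℓ = -1.
    · rw [ncard_neighborSet_cone, ncard_neighborSet_cone, Fintype.card_option]
      simp
      omega
  | hamiltonianConnected =>
    simp only [HamProperty.ell] at hℓ hdeg
    simp only [HamProperty.Holds] at h ⊢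
    rw [isHamiltonianConnected_iff (by omega)] at h ⊢
    intro x y hxy
    have h1 := h x y hxy
    -- If uv is the prescribed edge it is added in any case; otherwise it is not prescribed and can
    -- be exchanged, with one prescribed edge accounting for ℓ = 1.
    by_cases he : s(u, v) = s(x, y)
    · have h2 : edge u v = edge x y := by rw [edge, edge, he]
      rwa [h2, sup_assoc, sup_idem] at h1
    · rw [sup_right_comm] at h1
      refine h1.of_sup_edge (by omega) (by simpa using he) ?_
      have h3 : ∀ w, (G.neighborSet w).ncard ≤ ((G ⊔ edge x y).neighborSet w).ncard :=
        fun w => Set.ncard_le_ncard fun z hz => Or.inl hz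
      have := h3 u
      have := h3 v
      rw [Set.ncard_singleton]
      omega
  | edgeHamiltonian k =>
    simp only [HamProperty.ell] at hℓ hdeg
    simp only [HamProperty.Holds] at h ⊢
    rw [isEdgeHamiltonian_iff (by omega)] at h ⊢
    intro F hF hlin hk
    refine (h F (hF.trans le_sup_left) hlin hk).of_sup_edge (by omega) ?_ (by omega)
    exact fun h => hnadj (hF h)
  | vertexHamiltonian k =>
    simp only [HamProperty.ell] at hℓ hdeg
    simp only [HamProperty.Holds] at h ⊢
    intro S hS
    have h1 := h S hS
    have hcard := card_subtype_notMem S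
    by_cases hmem : u ∉ S ∧ v ∉ S
    · rw [isHamiltonian_iff_hasHamCycleThrough (by omega)] at h1 ⊢
      let u' : {v : V | v ∉ S} := ⟨u, hmem.1⟩
      let v' : {v : V | v ∉ S} := ⟨v, hmem.2⟩
      have hle : (G ⊔ edge u v).induce {v : V | v ∉ S} ≤
          G.induce {v : V | v ∉ S} ⊔ edge u' v' := by
        intro x y hxy
        have hxy : (G ⊔ edge u v).Adj (x : V) y := hxy
        rw [sup_adj, edge_adj] at hxy
        rw [sup_adj, edge_adj]
        refine hxy.imp (fun h => h) fun h => ?_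
        simpa [Subtype.ext_iff, u', v'] using h
      refine (h1.mono hle).of_sup_edge (by omega) (by simp) ?_
      -- Deleting S costs at most |S| in each degree and exactly |S| in the order, so a surplus of k
      -- ≥ |S| in the degree sum suffices.
      have h3 := ncard_neighborSet_induce_ge G S u'
      have h4 := ncard_neighborSet_induce_ge G S v'
      rw [Set.ncard_empty]
      simp only [u', v'] at h3 h4 ⊢
      omega
    · have heq : (G ⊔ edge u v).induce {v : V | v ∉ S} = G.induce {v : V | v ∉ S} := by
        ext x y
        simp only [comap_adj, Function.Embedding.subtype_apply, sup_adj, edge_adj,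
          or_iff_left_iff_imp]
        rintro ⟨⟨h3, h4⟩ | ⟨h3, h4⟩, -⟩
        · exact absurd ⟨h3 ▸ x.2, h4 ▸ y.2⟩ hmem
        · exact absurd ⟨h4 ▸ y.2, h3 ▸ x.2⟩ hmem
      rwa [heq] at h1

theorem hasHamCycleThrough_top_empty {W : Type*} [Fintype W] (h3 : 3 ≤ Fintype.card W) :
    HasHamCycleThrough (⊤ : SimpleGraph W) ∅ := by
  have h : IsLinearForest (⊥ : SimpleGraph W) := ⟨isAcyclic_bot, fun v => by
    simp [neighborSet]⟩
  simpa using h.hasHamCycleThrough_top h3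

theorem HamProperty.holds_top (P : HamProperty) (hℓ : P.ell ≤ (Fintype.card V : ℤ) - 3) :
    P.Holds (⊤ : SimpleGraph V) := by
  cases P with
  | hamiltonian =>
    simp only [HamProperty.ell] at hℓ
    exact (isHamiltonian_iff_hasHamCycleThrough (by omega)).2
      (hasHamCycleThrough_top_empty (by omega))
  | traceable =>
    simp only [HamProperty.ell] at hℓ
    refine (isTraceable_iff (by omega)).2 ((hasHamCycleThrough_top_empty ?_).mono ?_)
    · rw [Fintype.card_option]; omega
    · intro x y hxy
      refine ⟨hxy, ?_⟩
      rintro a b rfl rfl h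
      exact hxy (by rw [h])
  | hamiltonianConnected =>
    simp only [HamProperty.ell] at hℓ
    refine (isHamiltonianConnected_iff (by omega)).2 fun u v huv => ?_
    have hinj : Set.InjOn (fun j : ℕ => if j = 0 then u else v) (Set.Iic 1) := by
      intro i hi j hj h
      have hi : i ≤ 1 := hi
      have hj : j ≤ 1 := hj
      interval_cases i <;> interval_cases j <;> simp_all
    have h := (isLinearForest_pathThrough hinj).hasHamCycleThrough_top (by omega)
    rw [edgeSet_pathThrough hinj] at h
    have he : (fun j : ℕ => s(if j = 0 then u else v, if j + 1 = 0 then u else v)) '' Set.Iio 1 =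
        {s(u, v)} := by
      ext e
      simp [eq_comm]
    rw [he] at h
    exact h.mono (by simp)
  | edgeHamiltonian k =>
    simp only [HamProperty.ell] at hℓ
    exact (isEdgeHamiltonian_iff (by omega)).2 fun F _ hlin _ =>
      hlin.hasHamCycleThrough_top (by omega)
  | vertexHamiltonian k =>
    simp only [HamProperty.ell] at hℓ
    intro S hS
    have hcard := card_subtype_notMem S
    rw [isHamiltonian_iff_hasHamCycleThrough (by omega)]
    refine (hasHamCycleThrough_top_empty (by omega)).mono ?_
    intro x y hxy h
    exact hxy (Subtype.ext h)

end Stability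

/-! ### Why the split graphs lack the properties. -/

section Obstruction

open SimpleGraph Classical

/-- If `I` is independent with all its neighbours in `A`, and `A` together with `I` does not
exhaust the vertices, then a Hamilton cycle cannot contain many edges inside `A`. -/
theorem HasHamCycleThrough.card_lt {W : Type*} [Fintype W] {H : SimpleGraph W}
    {F : Set (Sym2 W)} (h : HasHamCycleThrough H F) {A I : Finset W} (hdisj : Disjoint A I)
    (hI : ∀ x ∈ I, ∀ w, H.Adj x w → w ∈ A) (hne : I.Nonempty) (hB : ∃ b, b ∉ A ∧ b ∉ I)
    (hF : ∀ e ∈ F, ∀ w ∈ e, w ∈ A) : #I + F.ncard < #A := by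
  obtain ⟨l, hnd, hmem, hadj, hlF⟩ := h
  set σ := l.formPerm with hσ
  -- From outside `A` and `I` the cycle cannot step into `I`, whose neighbours all lie in `A`. If it
  -- never stepped into `A` either, it would stay outside forever and miss `I`.
  have hexit : ∃ b, b ∉ A ∧ b ∉ I ∧ σ b ∈ A := by
    by_contra hno
    push Not at hno
    obtain ⟨b, hbA, hbI⟩ := hB
    obtain ⟨g, -, hsurj, hnext, hlast, hper⟩ := exists_enumeration rfl hnd hmem b
    have hstep : ∀ w, w ∉ A ∧ w ∉ I → σ w ∉ A ∧ σ w ∉ I := by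
      rintro w ⟨h1, h2⟩
      exact ⟨hno w h1 h2, fun h3 => h1 (hI _ h3 _ (hadj w).symm)⟩
    have hpos : 0 < Fintype.card W := Fintype.card_pos_iff.2 ⟨b⟩
    have hall : ∀ k, g k ∉ A ∧ g k ∉ I := by
      intro k
      induction k with
      | zero =>
        have := hstep b ⟨hbA, hbI⟩
        rwa [← hlast, hσ, hnext, Nat.sub_add_cancel hpos, hper] at this
      | succ k ih =>
        have := hstep _ ih
        rwa [hσ, hnext] at this
    obtain ⟨x, hx⟩ := hne
    obtain ⟨k, -, rfl⟩ := hsurj x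
    exact (hall k).2 hx
  obtain ⟨b, hbA, hbI, hb⟩ := hexit
  let Y : Finset W := {w ∈ A | s(w, σ w) ∈ F}
  have hY : F.ncard ≤ #Y := by
    rw [← Set.ncard_coe_finset]
    refine (Set.ncard_le_ncard (t := (fun w => s(w, σ w)) '' (Y : Set W)) ?_).trans
      (Set.ncard_image_le Y.finite_toSet)
    intro e he
    obtain ⟨w, rfl⟩ := hlF e he
    exact ⟨w, by simpa [Y] using ⟨hF _ he w (Sym2.mem_mk_left _ _), he⟩, rfl⟩
  have hIY : Disjoint I Y := hdisj.symm.mono_right (filter_subset _ _)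
  have hbY : b ∉ I ∪ Y := by
    rw [mem_union, not_or]
    exact ⟨hbI, fun h => hbA (mem_filter.1 h).1⟩
  -- The successor map is injective and sends into `A` three disjoint kinds of vertices: those of
  -- `I`, the initial vertices of prescribed edges, and the exit vertex b. The last one makes the
  -- inequality strict.
  have himage : (insert b (I ∪ Y)).image σ ⊆ A := by
    intro z hz
    obtain ⟨w, hw, rfl⟩ := mem_image.1 hz
    rcases mem_insert.1 hw with rfl | hw
    · exact hb
    rcases mem_union.1 hw with hw | hw
    · exact hI w hw _ (hadj w)
    · exact hF _ (mem_filter.1 hw).2 _ (Sym2.mem_mk_right _ _)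
  have hcard := card_le_card himage
  rw [card_image_of_injective _ σ.injective, card_insert_of_notMem hbY,
    card_union_of_disjoint hIY] at hcard
  omega

variable {V : Type*} [Fintype V]

/-- The vertex partition of the graphs in `𝒢^ℓ_n(i)`: the vertices in `A` are joined to all
others, those in `I` to `A` only. The rest of the vertices is the part `B`. -/
structure IsSplit (G : SimpleGraph V) (A I : Finset V) : Prop where
  disjoint : Disjoint A I
  adj : ∀ a ∈ A, ∀ w, w ≠ a → G.Adj a w
  mem_of_adj : ∀ x ∈ I, ∀ w, G.Adj x w → w ∈ A

/-- In each case the difference ℓ = |A| - |I| is used up: by one edge or a path of k edges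
prescribed inside A, by deleting k vertices of A, or, for ℓ = -1, by the apex of the cone joining A.
`HasHamCycleThrough.card_lt` then fails. -/
theorem IsSplit.not_holds {G : SimpleGraph V} {A I : Finset V} (h : IsSplit G A I)
    (P : HamProperty) (hℓ : P.ell ≤ (Fintype.card V : ℤ) - 3)
    (hne : I.Nonempty) (hB : ∃ b, b ∉ A ∧ b ∉ I) (hcard : (#A : ℤ) = #I + P.ell) :
    ¬ P.Holds G := by
  have hpos := hne.card_pos
  cases P with
  | hamiltonian =>
    simp only [HamProperty.ell] at hℓ hcard
    simp only [HamProperty.Holds]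
    rw [isHamiltonian_iff_hasHamCycleThrough (by omega)]
    intro hham
    have := hham.card_lt h.disjoint h.mem_of_adj hne hB (by simp)
    omega
  | traceable =>
    simp only [HamProperty.ell] at hℓ hcard
    simp only [HamProperty.Holds]
    rw [isTraceable_iff (by omega)]
    intro hham
    have := hham.card_lt (A := insertNone A) (I := I.map Function.Embedding.some) ?_ ?_
      (by simpa using hne) ?_ (by simp)
    · rw [card_map, card_insertNone] at this
      omega
    · rw [Finset.disjoint_left]
      rintro x hx hx'
      obtain ⟨y, hy, rfl⟩ := mem_map.1 hx'
      exact disjoint_left.1 h.disjoint (some_mem_insertNone.1 hx) hy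
    · intro x hx w hw
      obtain ⟨y, hy, rfl⟩ := mem_map.1 hx
      rcases w with _ | w
      · exact none_mem_insertNone
      · exact some_mem_insertNone.2 (h.mem_of_adj y hy w (cone_adj_some.1 hw))
    · obtain ⟨b, hbA, hbI⟩ := hB
      exact ⟨some b, by simpa using hbA, by simpa using hbI⟩
  | hamiltonianConnected =>
    simp only [HamProperty.ell] at hℓ hcard
    simp only [HamProperty.Holds]
    rw [isHamiltonianConnected_iff (by omega)]
    intro hham
    obtain ⟨u, hu, v, hv, huv⟩ := Finset.one_lt_card.1 (show 1 < #A by omega)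
    have hle : G ⊔ edge u v ≤ G := by
      rw [sup_le_iff]
      refine ⟨le_rfl, fun x y hxy => ?_⟩
      rw [edge_adj] at hxy
      rcases hxy with ⟨⟨rfl, rfl⟩ | ⟨rfl, rfl⟩, hne⟩
      · exact h.adj _ hu _ hne.symm
      · exact h.adj _ hv _ hne.symm
    have := ((hham u v huv).mono hle).card_lt h.disjoint h.mem_of_adj hne hB (by
      rintro e rfl w hw
      rcases Sym2.mem_iff.1 hw with rfl | rfl
      · exact hu
      · exact hv)
    rw [Set.ncard_singleton] at this
    omega
  | edgeHamiltonian k =>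
    simp only [HamProperty.ell] at hℓ hcard
    simp only [HamProperty.Holds]
    rw [isEdgeHamiltonian_iff (by omega)]
    intro hham
    obtain ⟨f, hfA, hfinj⟩ : ∃ f : ℕ → V, (∀ j ≤ k, f j ∈ A) ∧ Set.InjOn f (Set.Iic k) := by
      obtain ⟨a, -⟩ := hne
      let e := A.equivFin.symm
      refine ⟨fun j => if hj : j < #A then e ⟨j, hj⟩ else a, ?_, ?_⟩
      · intro j hj
        simp only [dif_pos (show j < #A by omega)]
        exact (e _).2
      · intro i hi j hj hij
        have hi : i ≤ k := hi
        have hj : j ≤ k := hj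
        simp only [dif_pos (show i < #A by omega), dif_pos (show j < #A by omega)] at hij
        have := e.injective (Subtype.ext hij)
        simpa using this
    have hedge : ∀ e ∈ (pathThrough f k).edgeSet, ∃ j < k, e = s(f j, f (j + 1)) := by
      intro e he
      rw [edgeSet_pathThrough hfinj] at he
      obtain ⟨j, hj, rfl⟩ := he
      exact ⟨j, hj, rfl⟩
    have hFA : ∀ e ∈ (pathThrough f k).edgeSet, ∀ w ∈ e, w ∈ A := by
      intro e he w hw
      obtain ⟨j, hj, rfl⟩ := hedge e he
      rcases Sym2.mem_iff.1 hw with rfl | rfl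
      · exact hfA j hj.le
      · exact hfA (j + 1) hj
    have hle : pathThrough f k ≤ G := by
      intro x y hxy
      exact h.adj x (hFA s(x, y) hxy x (Sym2.mem_mk_left _ _)) y hxy.ne'
    have := (hham _ hle (isLinearForest_pathThrough hfinj)
      (ncard_edgeSet_pathThrough hfinj).le).card_lt h.disjoint h.mem_of_adj hne hB hFA
    rw [ncard_edgeSet_pathThrough hfinj] at this
    omega
  | vertexHamiltonian k =>
    simp only [HamProperty.ell] at hℓ hcard
    simp only [HamProperty.Holds]
    intro hham
    obtain ⟨S, hSA, hS⟩ := Finset.exists_subset_card_eq (show k ≤ #A by omega)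
    have h1 := hham S hS.le
    have hcard' := card_subtype_notMem S
    rw [isHamiltonian_iff_hasHamCycleThrough (by omega)] at h1
    have hIS : ∀ x ∈ I, x ∉ S := fun x hx hxS => disjoint_left.1 h.disjoint (hSA hxS) hx
    have := h1.card_lt (A := A.subtype (· ∈ {v : V | v ∉ S}))
      (I := I.subtype (· ∈ {v : V | v ∉ S})) ?_ ?_ ?_ ?_ (by simp)
    · rw [card_subtype, card_subtype, Set.ncard_empty] at this
      have e1 : #{x ∈ I | x ∈ {v : V | v ∉ S}} = #I := by
        rw [Finset.filter_true_of_mem]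
        exact hIS
      have e2 : {x ∈ A | x ∈ {v : V | v ∉ S}} = A \ S := by
        ext; simp
      rw [e1, e2, card_sdiff_of_subset hSA] at this
      omega
    · rw [Finset.disjoint_left]
      intro x hx hx'
      exact disjoint_left.1 h.disjoint (mem_subtype.1 hx) (mem_subtype.1 hx')
    · intro x hx w hw
      exact mem_subtype.2 (h.mem_of_adj x (mem_subtype.1 hx) w hw)
    · obtain ⟨x, hx⟩ := hne
      exact ⟨⟨x, hIS x hx⟩, mem_subtype.2 hx⟩
    · obtain ⟨b, hbA, hbI⟩ := hB
      exact ⟨⟨b, fun hb => hbA (hSA hb)⟩, fun hb => hbA (mem_subtype.1 hb),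
        fun hb => hbI (mem_subtype.1 hb)⟩

end Obstruction

/-! ### A degree condition of Chvátal type. -/

section DegreeSequence

open SimpleGraph Classical

variable {V : Type*} [Fintype V]

theorem ncard_neighborSet_eq (G : SimpleGraph V) (v : V) :
    (G.neighborSet v).ncard = #{w | G.Adj v w} := by
  rw [← Set.ncard_coe_finset]
  congr 1
  ext w
  simp

theorem card_nonneighbors (G : SimpleGraph V) (v : V) :
    #{w | w ≠ v ∧ ¬ G.Adj v w} + (G.neighborSet v).ncard + 1 = Fintype.card V := by
  rw [ncard_neighborSet_eq]
  have h1 : ({w | w ≠ v ∧ ¬ G.Adj v w} : Finset V) = (insert v ({w | G.Adj v w} : Finset V))ᶜ := by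
    ext w; simp
  have h2 : #(insert v ({w | G.Adj v w} : Finset V)) = #{w | G.Adj v w} + 1 :=
    card_insert_of_notMem (by simp)
  rw [h1, add_assoc, ← h2, card_compl_add_card]

/-- A graph without one of the properties has many vertices of small degree. -/
theorem HamProperty.exists_degree_bound (P : HamProperty)
    (hℓ : P.ell ≤ (Fintype.card V : ℤ) - 3) {G : SimpleGraph V} (hG : ¬ P.Holds G) :
    ∃ i : ℕ, 1 ≤ i ∧ (2 * i : ℤ) ≤ (Fintype.card V : ℤ) - 1 - P.ell ∧
      i ≤ #{v | ((G.neighborSet v).ncard : ℤ) ≤ i + P.ell} ∧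
      (Fintype.card V : ℤ) - i - P.ell ≤
        #{v | (G.neighborSet v).ncard + i + 1 ≤ Fintype.card V} := by
  -- Adding edges only raises degrees, so bounds proved for an edge-maximal graph without P pass
  -- down to G.
  obtain ⟨H, hGH, hH⟩ := (Set.toFinite {H : SimpleGraph V | ¬ P.Holds H}).exists_le_maximal hG
  have hdeg : ∀ v, (G.neighborSet v).ncard ≤ (H.neighborSet v).ncard :=
    fun v => Set.ncard_le_ncard fun w hw => hGH hw
  suffices h : ∃ i : ℕ, 1 ≤ i ∧ (2 * i : ℤ) ≤ (Fintype.card V : ℤ) - 1 - P.ell ∧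
      i ≤ #{v | ((H.neighborSet v).ncard : ℤ) ≤ i + P.ell} ∧
      (Fintype.card V : ℤ) - i - P.ell ≤
        #{v | (H.neighborSet v).ncard + i + 1 ≤ Fintype.card V} by
    obtain ⟨i, h1, h2, h3, h4⟩ := h
    refine ⟨i, h1, h2, h3.trans (card_le_card ?_),
      h4.trans (Int.ofNat_le.2 (card_le_card ?_))⟩
    · intro v hv
      simp only [mem_filter, mem_univ, true_and] at hv ⊢
      have := hdeg v
      omega
    · intro v hv
      simp only [mem_filter, mem_univ, true_and] at hv ⊢
      have := hdeg v
      omega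
  set n := Fintype.card V with hn
  have hsum : ∀ u v, u ≠ v → ¬ H.Adj u v →
      ((H.neighborSet u).ncard : ℤ) + (H.neighborSet v).ncard < n + P.ell := by
    intro u v huv hadj
    by_contra hle
    refine hH.1 (P.holds_of_sup_edge hℓ hadj (not_lt.1 hle) ?_)
    by_contra hP
    have := hH.2 hP le_sup_left
    exact hadj (this (Or.inr (by simp [edge_adj, huv])))
  let N : Finset (V × V) := {p | p.1 ≠ p.2 ∧ ¬ H.Adj p.1 p.2}
  have hN : N.Nonempty := by
    by_contra hN
    rw [not_nonempty_iff_eq_empty] at hN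
    have htop : H = ⊤ := by
      ext u v
      rw [top_adj]
      refine ⟨fun h => h.ne, fun h => ?_⟩
      by_contra hadj
      have : (u, v) ∈ N := by simp [N, h, hadj]
      simp [hN] at this
    exact hH.1 (htop ▸ P.holds_top hℓ)
  obtain ⟨p, hp, hmax⟩ := N.exists_max_image
    (fun p => (H.neighborSet p.1).ncard + (H.neighborSet p.2).ncard) hN
  obtain ⟨u, v, huv, hadj, hle, hmax⟩ : ∃ u v, u ≠ v ∧ ¬ H.Adj u v ∧
      (H.neighborSet u).ncard ≤ (H.neighborSet v).ncard ∧
      ∀ x y, x ≠ y → ¬ H.Adj x y → (H.neighborSet x).ncard + (H.neighborSet y).ncard ≤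
        (H.neighborSet u).ncard + (H.neighborSet v).ncard := by
    obtain ⟨h1, h2⟩ := (mem_filter.1 hp).2
    have hmax' : ∀ x y, x ≠ y → ¬ H.Adj x y →
        (H.neighborSet x).ncard + (H.neighborSet y).ncard ≤
        (H.neighborSet p.1).ncard + (H.neighborSet p.2).ncard :=
      fun x y hxy hadj => hmax (x, y) (by simp [N, hxy, hadj])
    rcases le_total (H.neighborSet p.1).ncard (H.neighborSet p.2).ncard with h | h
    · exact ⟨p.1, p.2, h1, h2, h, hmax'⟩
    · refine ⟨p.2, p.1, h1.symm, fun h' => h2 h'.symm, h, fun x y hxy hadj => ?_⟩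
      rw [add_comm (H.neighborSet p.2).ncard]
      exact hmax' x y hxy hadj
  have hs := hsum u v huv hadj
  have hu := card_nonneighbors H u
  have hv := card_nonneighbors H v
  -- The index wanted is d(u) - ℓ. When this is not positive, i = 1 serves: u has small degree, and
  -- each of its at least n - 1 - ℓ nonneighbours misses u.
  rcases le_or_gt ((H.neighborSet u).ncard : ℤ) P.ell with hsmall | hlarge
  · refine ⟨1, le_rfl, by push_cast; omega, ?_, ?_⟩
    · rw [Nat.one_le_iff_ne_zero, ← Nat.pos_iff_ne_zero, card_pos]
      exact ⟨u, by simp only [mem_filter, mem_univ, true_and]; push_cast; omega⟩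
    · have hsub : #{w | w ≠ u ∧ ¬ H.Adj u w} ≤
          #{w | (H.neighborSet w).ncard + 1 + 1 ≤ n} := by
        apply card_le_card
        intro w hw
        simp only [mem_filter, mem_univ, true_and] at hw ⊢
        have h1 := card_nonneighbors H w
        have h2 : 0 < #{z | z ≠ w ∧ ¬ H.Adj w z} := card_pos.2
          ⟨u, by simp only [mem_filter, mem_univ, true_and]
                 exact ⟨hw.1.symm, fun h => hw.2 h.symm⟩⟩
        omega
      push_cast
      omega
  · obtain ⟨i, hi⟩ : ∃ i : ℕ, (i : ℤ) = (H.neighborSet u).ncard - P.ell :=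
      ⟨((H.neighborSet u).ncard - P.ell).toNat, by omega⟩
    refine ⟨i, by omega, by omega, ?_, ?_⟩
    -- By maximality of the degree sum of u and v, nonneighbours of v have degree at most d(u), and
    -- nonneighbours of u at most d(v). The bound d(u) + d(v) < n + ℓ makes both sets large enough.
    · have hsub : #{w | w ≠ v ∧ ¬ H.Adj v w} ≤
          #{w | ((H.neighborSet w).ncard : ℤ) ≤ i + P.ell} := by
        apply card_le_card
        intro w hw
        simp only [mem_filter, mem_univ, true_and] at hw ⊢
        have := hmax w v hw.1 (fun h => hw.2 h.symm)
        omega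
      omega
    · have hsub : insert u ({w | w ≠ u ∧ ¬ H.Adj u w} : Finset V) ⊆
          ({w | (H.neighborSet w).ncard + i + 1 ≤ n} : Finset V) := by
        intro w hw
        rcases mem_insert.1 hw with rfl | hw
        · simp only [mem_filter, mem_univ, true_and]
          omega
        · simp only [mem_filter, mem_univ, true_and] at hw ⊢
          have := hmax u w hw.1.symm hw.2
          omega
      have := card_le_card hsub
      rw [card_insert_of_notMem (by simp)] at this
      omega

end DegreeSequence

/-! ### Comparing binomial sums, with the case of equality. -/

section Counting

open SimpleGraph Classical

variable {V : Type*} [Fintype V]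

/-- The value of `∑ d(v).choose t` for the graph `K_a + (I_i ∪ K_b)`. -/
def splitValue (t a i b : ℕ) : ℕ :=
  a * (a + i + b - 1).choose t + i * a.choose t + b * (a + b - 1).choose t

/-- The condition t ≤ y is essential: otherwise both binomials vanish and nothing follows. This is
the source of the thresholds on t in the theorem. -/
theorem eq_of_choose_eq {x y t : ℕ} (hxy : x ≤ y) (ht1 : 1 ≤ t) (hty : t ≤ y)
    (h : x.choose t = y.choose t) : x = y := by
  by_contra hne
  obtain ⟨z, rfl⟩ : ∃ z, y = z + 1 := ⟨y - 1, by omega⟩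
  obtain ⟨s, rfl⟩ : ∃ s, t = s + 1 := ⟨t - 1, by omega⟩
  have h1 : x.choose (s + 1) ≤ z.choose (s + 1) := Nat.choose_le_choose _ (by omega)
  have h2 : 0 < z.choose s := Nat.choose_pos (by omega)
  rw [h, Nat.choose_succ_succ'] at h1
  omega

/-- The prescribed bounds on the degrees in `K_a + (I_i ∪ K_b)`. -/
def splitBound (a i b : ℕ) (A I : Finset V) (v : V) : ℕ :=
  if v ∈ A then a + i + b - 1 else if v ∈ I then a else a + b - 1

theorem card_rest {a i b : ℕ} {A I : Finset V} (hcard : Fintype.card V = a + i + b)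
    (hA : #A = a) (hI : #I = i) (hdisj : Disjoint A I) : #(A ∪ I)ᶜ = b := by
  rw [card_compl, card_union_of_disjoint hdisj]
  omega

theorem sum_choose_splitBound {a i b t : ℕ} {A I : Finset V}
    (hcard : Fintype.card V = a + i + b) (hA : #A = a) (hI : #I = i) (hdisj : Disjoint A I) :
    ∑ v, (splitBound a i b A I v).choose t = splitValue t a i b := by
  have hB := card_rest hcard hA hI hdisj
  rw [← sum_add_sum_compl (A ∪ I), sum_union hdisj, splitValue]
  congr 1
  · congr 1
    · rw [← hA, sum_const_nat]
      intro v hv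
      rw [splitBound, if_pos hv]
    · rw [← hI, sum_const_nat]
      intro v hv
      rw [splitBound, if_neg (fun h => disjoint_left.1 hdisj h hv), if_pos hv]
  · rw [sum_const_nat, hB]
    intro v hv
    rw [mem_compl, mem_union, not_or] at hv
    rw [splitBound, if_neg hv.1, if_neg hv.2]

theorem ncard_neighborSet_lt_card (G : SimpleGraph V) (v : V) :
    (G.neighborSet v).ncard + 1 ≤ Fintype.card V := by
  have := card_nonneighbors G v
  omega

theorem exists_parts {G : SimpleGraph V} {a i b : ℕ} (hcard : Fintype.card V = a + i + b)
    (hb : 1 ≤ b) (hlow : i ≤ #{v | (G.neighborSet v).ncard ≤ a})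
    (hmid : i + b ≤ #{v | (G.neighborSet v).ncard ≤ a + b - 1}) :
    ∃ A I : Finset V, Disjoint A I ∧ #A = a ∧ #I = i ∧
      ∀ v, (G.neighborSet v).ncard ≤ splitBound a i b A I v := by
  obtain ⟨I, hIL, hI⟩ := exists_subset_card_eq hlow
  have hIM : I ⊆ ({v | (G.neighborSet v).ncard ≤ a + b - 1} : Finset V) := by
    intro v hv
    have := (mem_filter.1 (hIL hv)).2
    simp only [mem_filter, mem_univ, true_and]
    omega
  obtain ⟨M, hIM', hM, hMc⟩ := exists_subsuperset_card_eq hIM (by omega) hmid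
  refine ⟨Mᶜ, I, ?_, ?_, hI, ?_⟩
  · exact (disjoint_compl_left (a := M)).mono_right hIM'
  · rw [card_compl]; omega
  · intro v
    rw [splitBound]
    split_ifs with h1 h2
    · have := ncard_neighborSet_lt_card G v
      omega
    · exact (mem_filter.1 (hIL h2)).2
    · exact (mem_filter.1 (hM (not_not.1 (fun h => h1 (mem_compl.2 h))))).2

theorem degreeChooseSum_le_splitValue {G : SimpleGraph V} {a i b t : ℕ} {A I : Finset V}
    (hcard : Fintype.card V = a + i + b) (hA : #A = a) (hI : #I = i) (hdisj : Disjoint A I)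
    (hdeg : ∀ v, (G.neighborSet v).ncard ≤ splitBound a i b A I v) :
    degreeChooseSum t G ≤ splitValue t a i b := by
  rw [← sum_choose_splitBound hcard hA hI hdisj]
  exact sum_le_sum fun v _ => Nat.choose_le_choose _ (hdeg v)

/-- The vertices outside of `A` and `I` are pairwise adjacent. -/
def RestComplete (G : SimpleGraph V) (A I : Finset V) : Prop :=
  ∀ u v, u ∉ A → u ∉ I → v ∉ A → v ∉ I → u ≠ v → G.Adj u v

/-- Equality holds termwise, so the vertices of A have full degree. A vertex of I is then joined to
all of A, which already exhausts its degree bound. A vertex of B misses all of I, so attaining its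
bound leaves it no further nonneighbour. -/
theorem isSplit_of_degreeChooseSum_eq {G : SimpleGraph V} {a i b t : ℕ} {A I : Finset V}
    (hcard : Fintype.card V = a + i + b) (hA : #A = a) (hI : #I = i) (hdisj : Disjoint A I)
    (hdeg : ∀ v, (G.neighborSet v).ncard ≤ splitBound a i b A I v)
    (ht1 : 1 ≤ t) (htn : t ≤ a + i + b - 1)
    (heq : degreeChooseSum t G = splitValue t a i b) :
    IsSplit G A I ∧ (t ≤ a + b - 1 → RestComplete G A I) := by
  rw [← sum_choose_splitBound hcard hA hI hdisj, degreeChooseSum,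
    sum_eq_sum_iff_of_le fun v _ => Nat.choose_le_choose _ (hdeg v)] at heq
  have hadj : ∀ x ∈ A, ∀ w, w ≠ x → G.Adj x w := by
    intro x hx w hw
    have hb : splitBound a i b A I x = a + i + b - 1 := if_pos hx
    have h1 := eq_of_choose_eq (hdeg x) ht1 (by rw [hb]; exact htn) (heq x (mem_univ x))
    rw [hb] at h1
    have h2 := card_nonneighbors G x
    by_contra hnadj
    have h3 : 0 < #{w | w ≠ x ∧ ¬ G.Adj x w} := card_pos.2 ⟨w, by simp [hw, hnadj]⟩
    omega
  have hmem : ∀ x ∈ I, ∀ w, G.Adj x w → w ∈ A := by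
    intro x hx w hw
    have hxA : x ∉ A := fun h => disjoint_left.1 hdisj h hx
    have hb : splitBound a i b A I x = a := by
      rw [splitBound, if_neg hxA, if_pos hx]
    have h1 := hdeg x
    rw [hb, ncard_neighborSet_eq, ← hA] at h1
    have hsub : A ⊆ ({w | G.Adj x w} : Finset V) := fun y hy => by
      simp only [mem_filter, mem_univ, true_and]
      exact (hadj y hy x (fun h => hxA (h ▸ hy))).symm
    rw [eq_of_subset_of_card_le hsub h1]
    simpa using hw
  refine ⟨⟨hdisj, hadj, hmem⟩, fun ht u v huA huI hvA hvI huv => ?_⟩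
  have hb : splitBound a i b A I u = a + b - 1 := by
    rw [splitBound, if_neg huA, if_neg huI]
  have h1 := eq_of_choose_eq (hdeg u) ht1 (by rw [hb]; exact ht) (heq u (mem_univ u))
  rw [hb] at h1
  have h2 := card_nonneighbors G u
  by_contra hnadj
  have hsub : insert v I ⊆ ({w | w ≠ u ∧ ¬ G.Adj u w} : Finset V) := by
    intro w hw
    simp only [mem_filter, mem_univ, true_and]
    rcases mem_insert.1 hw with rfl | hw
    · exact ⟨huv.symm, hnadj⟩
    · exact ⟨fun h => huI (h ▸ hw), fun h => huA (hmem w hw u h.symm)⟩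
  have h3 := card_le_card hsub
  rw [card_insert_of_notMem hvI, hI] at h3
  have h4 : 1 ≤ b := by
    rw [← card_rest hcard hA hI hdisj, Nat.one_le_iff_ne_zero, ← Nat.pos_iff_ne_zero, card_pos]
    exact ⟨u, by simp [huA, huI]⟩
  omega

theorem IsSplit.le_ncard_neighborSet {G : SimpleGraph V} {A I : Finset V} (h : IsSplit G A I)
    (hne : I.Nonempty) (v : V) : #A ≤ (G.neighborSet v).ncard := by
  rw [ncard_neighborSet_eq]
  by_cases hv : v ∈ A
  · obtain ⟨x, hx⟩ := hne
    have hxA : x ∉ A := fun h' => disjoint_left.1 h.disjoint h' hx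
    have hsub : insert x (A.erase v) ⊆ ({w | G.Adj v w} : Finset V) := by
      intro w hw
      simp only [mem_filter, mem_univ, true_and]
      refine h.adj v hv w ?_
      rintro rfl
      rcases mem_insert.1 hw with rfl | hw
      · exact hxA hv
      · exact (mem_erase.1 hw).1 rfl
    have := card_le_card hsub
    rw [card_insert_of_notMem (fun h' => hxA (mem_of_mem_erase h')), card_erase_of_mem hv] at this
    have := card_pos.2 ⟨v, hv⟩
    omega
  · apply card_le_card
    intro w hw
    simp only [mem_filter, mem_univ, true_and]
    exact (h.adj w hw v (fun h' => hv (h' ▸ hw))).symm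

theorem IsSplit.degreeChooseSum_eq {G : SimpleGraph V} {a i b t : ℕ} {A I : Finset V}
    (h : IsSplit G A I) (hcard : Fintype.card V = a + i + b) (hA : #A = a) (hI : #I = i)
    (hrest : RestComplete G A I ∨ a + b - 1 < t) :
    degreeChooseSum t G = splitValue t a i b := by
  rw [← sum_choose_splitBound hcard hA hI h.disjoint, degreeChooseSum]
  refine sum_congr rfl fun v _ => ?_
  by_cases hvA : v ∈ A
  · have hb : splitBound a i b A I v = a + i + b - 1 := if_pos hvA
    have h1 := card_nonneighbors G v
    have h2 : #{w | w ≠ v ∧ ¬ G.Adj v w} = 0 := by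
      rw [card_eq_zero, filter_eq_empty_iff]
      rintro w - ⟨hw, hw'⟩
      exact hw' (h.adj v hvA w hw)
    rw [hb]
    congr 1
    omega
  by_cases hvI : v ∈ I
  · have hb : splitBound a i b A I v = a := by rw [splitBound, if_neg hvA, if_pos hvI]
    rw [hb, ncard_neighborSet_eq, ← hA]
    congr 2
    ext w
    simp only [mem_filter, mem_univ, true_and]
    exact ⟨h.mem_of_adj v hvI w, fun hw => (h.adj w hw v (fun h' => hvA (h' ▸ hw))).symm⟩
  have hb : splitBound a i b A I v = a + b - 1 := by
    rw [splitBound, if_neg hvA, if_neg hvI]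
  have h1 := card_nonneighbors G v
  have hsub : I ⊆ ({w | w ≠ v ∧ ¬ G.Adj v w} : Finset V) := by
    intro w hw
    simp only [mem_filter, mem_univ, true_and]
    exact ⟨fun h' => hvI (h' ▸ hw), fun h' => hvA (h.mem_of_adj w hw v h'.symm)⟩
  rw [hb]
  rcases hrest with hrest | hrest
  · have heq : ({w | w ≠ v ∧ ¬ G.Adj v w} : Finset V) = I := by
      refine (subset_antisymm hsub fun w hw => ?_).symm
      simp only [mem_filter, mem_univ, true_and] at hw
      by_contra hwI
      by_cases hwA : w ∈ A
      · exact hw.2 (h.adj w hwA v hw.1.symm).symm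
      · exact hw.2 (hrest v w hvA hvI hwA hwI hw.1.symm)
    rw [heq] at h1
    congr 1
    omega
  · have h2 := card_le_card hsub
    rw [Nat.choose_eq_zero_of_lt hrest, Nat.choose_eq_zero_of_lt (by omega)]

/-- Strict quasi-convexity of the values in the parameter `i`. -/
theorem splitValue_lt_max {t a i b : ℕ} (hb : 1 ≤ b) (ht1 : 1 ≤ t) (htn : t ≤ a + i + b + 3) :
    splitValue t (a + 1) (i + 1) (b + 2) <
      max (splitValue t a i (b + 4)) (splitValue t (a + 2) (i + 2) b) := by
  obtain ⟨s, rfl⟩ : ∃ s, t = s + 1 := ⟨t - 1, by omega⟩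
  obtain ⟨c, rfl⟩ : ∃ c, b = c + 1 := ⟨b - 1, by omega⟩
  simp only [splitValue]
  rw [show a + 1 + (i + 1) + (c + 1 + 2) - 1 = a + i + c + 4 by omega,
    show a + 1 + (c + 1 + 2) - 1 = a + c + 3 by omega,
    show a + i + (c + 1 + 4) - 1 = a + i + c + 4 by omega,
    show a + (c + 1 + 4) - 1 = a + c + 4 by omega,
    show a + 2 + (i + 2) + (c + 1) - 1 = a + i + c + 4 by omega,
    show a + 2 + (c + 1) - 1 = a + c + 2 by omega]
  have hN : 0 < (a + i + c + 4).choose (s + 1) := Nat.choose_pos (by omega)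
  set N := (a + i + c + 4).choose (s + 1)
  rw [lt_max_iff]
  -- In this range the values are strictly convex: by Pascal's rule the second difference is (i + 2)
  -- p1 - i p0 + (c + 5) r1 - (c + 1) r0 > 0, the multiples of N cancelling. For larger t only the
  -- terms with N survive, and the values increase strictly with the number of dominating vertices.
  by_cases ht : s ≤ a + c + 3
  · have e1 : (a + 1).choose (s + 1) = a.choose s + a.choose (s + 1) := Nat.choose_succ_succ _ _
    have e2 : (a + 2).choose (s + 1) = (a + 1).choose s + (a + 1).choose (s + 1) :=
      Nat.choose_succ_succ _ _
    have e3 : (a + c + 3).choose (s + 1) = (a + c + 2).choose s + (a + c + 2).choose (s + 1) :=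
      Nat.choose_succ_succ _ _
    have e4 : (a + c + 4).choose (s + 1) = (a + c + 3).choose s + (a + c + 3).choose (s + 1) :=
      Nat.choose_succ_succ _ _
    have h1 : a.choose s ≤ (a + 1).choose s := Nat.choose_le_choose _ (by omega)
    have h2 : (a + c + 2).choose s ≤ (a + c + 3).choose s := Nat.choose_le_choose _ (by omega)
    have h3 : 0 < (a + c + 3).choose s := Nat.choose_pos ht
    rw [e2, e1, e4, e3]
    generalize (a + 1).choose s = p1 at *
    generalize a.choose s = p0 at *
    generalize a.choose (s + 1) = q at *
    generalize (a + c + 3).choose s = r1 at *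
    generalize (a + c + 2).choose s = r0 at *
    generalize (a + c + 2).choose (s + 1) = r at *
    by_contra hcon
    push Not at hcon
    obtain ⟨c1, c2⟩ := hcon
    have k1 : i * p0 ≤ i * p1 := Nat.mul_le_mul_left _ h1
    have k2 : c * r0 ≤ c * r1 := Nat.mul_le_mul_left _ h2
    nlinarith
  · right
    rw [Nat.choose_eq_zero_of_lt (show a + c + 3 < s + 1 by omega),
      Nat.choose_eq_zero_of_lt (show a + c + 2 < s + 1 by omega),
      Nat.choose_eq_zero_of_lt (show a + 2 < s + 1 by omega),
      Nat.choose_eq_zero_of_lt (show a + 1 < s + 1 by omega)]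
    nlinarith

end Counting

/-! ### Identifying split graphs with the members of the family. -/

section Recognition

open SimpleGraph Classical

/-- Two partitions into three parts of matching sizes are related by a bijection. -/
theorem exists_equiv_of_parts {V W : Type*} [Fintype V] [Fintype W] {A I : Finset V}
    {A' I' : Finset W} (hcard : Fintype.card V = Fintype.card W) (hA : #A = #A') (hI : #I = #I')
    (hd : Disjoint A I) (hd' : Disjoint A' I') :
    ∃ e : V ≃ W, (∀ v, e v ∈ A' ↔ v ∈ A) ∧ (∀ v, e v ∈ I' ↔ v ∈ I) := by
  let f : V → Fin 3 := fun v => if v ∈ A then 0 else if v ∈ I then 1 else 2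
  let g : W → Fin 3 := fun w => if w ∈ A' then 0 else if w ∈ I' then 1 else 2
  have hf0 : ∀ v, f v = 0 ↔ v ∈ A := fun v => by
    simp only [f]; split_ifs <;> simp_all
  have hf1 : ∀ v, f v = 1 ↔ v ∈ I := fun v => by
    have := @disjoint_left _ A I
    simp only [f]; split_ifs <;> simp_all
  have hf2 : ∀ v, f v = 2 ↔ v ∈ (A ∪ I)ᶜ := fun v => by
    simp only [f]; split_ifs <;> simp_all
  have hg0 : ∀ v, g v = 0 ↔ v ∈ A' := fun v => by
    simp only [g]; split_ifs <;> simp_all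
  have hg1 : ∀ v, g v = 1 ↔ v ∈ I' := fun v => by
    have := @disjoint_left _ A' I'
    simp only [g]; split_ifs <;> simp_all
  have hg2 : ∀ v, g v = 2 ↔ v ∈ (A' ∪ I')ᶜ := fun v => by
    simp only [g]; split_ifs <;> simp_all
  have hfib : ∀ k, Fintype.card {v // f v = k} = Fintype.card {w // g w = k} := by
    intro k
    match k with
    | 0 => simpa [hf0, hg0] using hA
    | 1 => simpa [hf1, hg1] using hI
    | 2 =>
      simp only [hf2, hg2, Fintype.card_coe]
      rw [card_compl, card_compl, card_union_of_disjoint hd, card_union_of_disjoint hd', hcard, hA,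
        hI]
  let e : V ≃ W := ((Equiv.sigmaFiberEquiv f).symm.trans
    (Equiv.sigmaCongrRight fun k => Fintype.equivOfCardEq (hfib k))).trans (Equiv.sigmaFiberEquiv g)
  have he : ∀ v, g (e v) = f v := fun v =>
    (Fintype.equivOfCardEq (hfib (f v)) ⟨v, rfl⟩).2
  exact ⟨e, fun v => by rw [← hg0, he, hf0], fun v => by rw [← hg1, he, hf1]⟩

section BaseGraph

variable {n a i : ℕ} {ℓ : ℤ}

/-- The vertices of `baseGraph` carrying the `K_{i+ℓ}`. -/
def baseA (n : ℕ) (ℓ i : ℤ) : Finset (Fin n) := {v | InA n ℓ i v}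

/-- The vertices of `baseGraph` carrying the independent set `I_i`. -/
def baseI (n : ℕ) (ℓ i : ℤ) : Finset (Fin n) := {v | ¬ InA n ℓ i v ∧ ¬ InB n ℓ i v}

theorem mem_baseA {v : Fin n} {i : ℤ} : v ∈ baseA n ℓ i ↔ InA n ℓ i v := by simp [baseA]

theorem mem_baseI {v : Fin n} {i : ℤ} :
    v ∈ baseI n ℓ i ↔ ¬ InA n ℓ i v ∧ ¬ InB n ℓ i v := by simp [baseI]

theorem disjoint_baseA_baseI {i : ℤ} : Disjoint (baseA n ℓ i) (baseI n ℓ i) := by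
  rw [Finset.disjoint_left]
  intro v hv hv'
  exact (mem_baseI.1 hv').1 (mem_baseA.1 hv)

theorem card_filter_val_lt {m : ℕ} (hm : m ≤ n) : #{v : Fin n | (v : ℕ) < m} = m := by
  rw [Fin.card_filter_val_lt]
  omega

theorem card_baseA (ha : (a : ℤ) = i + ℓ) (hn : a + i ≤ n) : #(baseA n ℓ i) = a := by
  rw [← card_filter_val_lt (show a ≤ n by omega)]
  congr 1
  ext v
  simp only [mem_baseA, InA, mem_filter, mem_univ, true_and]
  omega

theorem card_baseI (ha : (a : ℤ) = i + ℓ) (hn : a + i ≤ n) : #(baseI n ℓ i) = i := by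
  have h1 : baseA n ℓ i ∪ baseI n ℓ i = ({v | (v : ℕ) < a + i} : Finset (Fin n)) := by
    ext v
    simp only [mem_union, mem_baseA, mem_baseI, InA, InB, mem_filter, mem_univ, true_and]
    omega
  have h2 := card_union_of_disjoint (disjoint_baseA_baseI (n := n) (ℓ := ℓ) (i := i))
  rw [h1, card_filter_val_lt hn, card_baseA ha hn] at h2
  omega

theorem isSplit_of_mem_family {i : ℤ} (hi : 0 ≤ i) {H : SimpleGraph (Fin n)}
    (hH : H ∈ family n ℓ i) : IsSplit H (baseA n ℓ i) (baseI n ℓ i) := by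
  refine ⟨disjoint_baseA_baseI, ?_, ?_⟩
  · intro v hv w hw
    by_contra hadj
    have hvA := mem_baseA.1 hv
    have := (hH.2 v w ⟨hw.symm, Or.inl hvA⟩ hadj).1
    simp only [InA, InB] at hvA this
    omega
  · intro x hx w hw
    obtain ⟨hxA, hxB⟩ := mem_baseI.1 hx
    rcases (hH.1 hw).2 with h | h | ⟨h, -⟩
    · exact absurd h hxA
    · exact mem_baseA.2 h
    · exact absurd h hxB

theorem baseGraph_mem_family {i : ℤ} : baseGraph n ℓ i ∈ family n ℓ i :=
  ⟨le_rfl, fun _ _ h h' => absurd h h'⟩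

theorem restComplete_baseGraph {i : ℤ} :
    RestComplete (baseGraph n ℓ i) (baseA n ℓ i) (baseI n ℓ i) := by
  intro u v huA huI hvA hvI huv
  rw [mem_baseA] at huA hvA
  rw [mem_baseI] at huI hvI
  refine ⟨huv, ?_⟩
  tauto

variable {V : Type*} {H : SimpleGraph V}

theorem IsSplit.of_iso {W : Type*} {G : SimpleGraph W} {A I : Finset W}
    (φ : H ≃g G) (h : IsSplit G A I) :
    IsSplit H (A.map φ.toEquiv.symm.toEmbedding) (I.map φ.toEquiv.symm.toEmbedding) := by
  have hm : ∀ (S : Finset W) (v : V), v ∈ S.map φ.toEquiv.symm.toEmbedding ↔ φ v ∈ S :=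
    fun S v => by rw [mem_map_equiv]; rfl
  refine ⟨?_, ?_, ?_⟩
  · rw [Finset.disjoint_left]
    intro v hv hv'
    exact disjoint_left.1 h.disjoint ((hm _ _).1 hv) ((hm _ _).1 hv')
  · intro v hv w hw
    rw [← φ.map_adj_iff]
    exact h.adj _ ((hm _ _).1 hv) _ fun h' => hw (φ.injective h')
  · intro v hv w hw
    rw [hm]
    exact h.mem_of_adj _ ((hm _ _).1 hv) _ (φ.map_adj_iff.2 hw)

variable [Fintype V]

theorem exists_iso_mem_family (hV : Fintype.card V = n) (ha : (a : ℤ) = i + ℓ) (hn : a + i ≤ n)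
    {A I : Finset V} (h : IsSplit H A I) (hA : #A = a) (hI : #I = i) :
    ∃ G ∈ family n ℓ i, Nonempty (H ≃g G) ∧ (RestComplete H A I → G = baseGraph n ℓ i) := by
  obtain ⟨e, heA, heI⟩ := exists_equiv_of_parts (A := A) (I := I) (A' := baseA n ℓ i)
    (I' := baseI n ℓ i) (by simpa using hV) (by rw [hA, card_baseA ha hn])
    (by rw [hI, card_baseI ha hn]) h.disjoint disjoint_baseA_baseI
  have hA' : ∀ x, InA n ℓ i x ↔ e.symm x ∈ A := fun x => by
    rw [← heA, e.apply_symm_apply, mem_baseA]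
  have hB' : ∀ x, InB n ℓ i x ↔ e.symm x ∉ A ∧ e.symm x ∉ I := fun x => by
    rw [← heA, ← heI, e.apply_symm_apply, mem_baseA, mem_baseI]
    simp only [InA, InB]
    omega
  let G : SimpleGraph (Fin n) := H.comap e.symm
  have hG : ∀ x y, G.Adj x y ↔ H.Adj (e.symm x) (e.symm y) := fun x y => Iff.rfl
  have hle : G ≤ baseGraph n ℓ i := by
    intro x y hxy
    rw [hG] at hxy
    refine ⟨fun h' => hxy.ne (by rw [h']), ?_⟩
    rw [hA', hA', hB', hB']
    by_contra hno
    have h1 : e.symm x ∈ I → e.symm y ∈ A := fun hx => h.mem_of_adj _ hx _ hxy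
    have h2 : e.symm y ∈ I → e.symm x ∈ A := fun hx => h.mem_of_adj _ hx _ hxy.symm
    tauto
  have hmiss : ∀ u v, (baseGraph n ℓ i).Adj u v → ¬ G.Adj u v →
      InB n ℓ i u ∧ InB n ℓ i v := by
    rintro x y ⟨hne, hxy⟩ hno
    rw [hG] at hno
    rcases hxy with hx | hy | hB
    · exact absurd (h.adj _ ((hA' x).1 hx) _ fun h' => hne (e.symm.injective h').symm) hno
    · exact absurd (h.adj _ ((hA' y).1 hy) _ fun h' => hne (e.symm.injective h')).symm hno
    · exact hB
  refine ⟨G, ⟨hle, hmiss⟩, ⟨⟨e, by simp [hG]⟩⟩, fun hrest => le_antisymm hle fun x y hxy => ?_⟩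
  by_contra hno
  obtain ⟨hx, hy⟩ := hmiss x y hxy hno
  rw [hB'] at hx hy
  exact hno (hrest _ _ hx.1 hx.2 hy.1 hy.2 fun h' => hxy.ne (e.symm.injective h'))

/-- The extremal graphs associated with the index `i`. -/
def extremalAt (V : Type*) (n : ℕ) (ℓ i : ℤ) (t : ℕ) : Set (SimpleGraph V) :=
  if (t : ℤ) ≤ n - i - 1 then copiesOf V (baseGraph n ℓ i) else copiesOfFamily V (family n ℓ i)

/-- An isomorphism-free description, in the form in which the equality analysis produces the graphs
and the obstruction consumes them. -/
theorem mem_extremalAt_iff {t : ℕ} (hV : Fintype.card V = n) (ha : (a : ℤ) = i + ℓ)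
    (hn : a + i ≤ n) :
    H ∈ extremalAt V n ℓ i t ↔ ∃ A I : Finset V, IsSplit H A I ∧ #A = a ∧ #I = i ∧
      ((t : ℤ) ≤ n - i - 1 → RestComplete H A I) := by
  constructor
  · intro hH
    have key : ∀ {G : SimpleGraph (Fin n)} (φ : H ≃g G), G ∈ family n ℓ i →
        IsSplit H ((baseA n ℓ i).map φ.toEquiv.symm.toEmbedding)
          ((baseI n ℓ i).map φ.toEquiv.symm.toEmbedding) :=
      fun φ hG => (isSplit_of_mem_family (by omega) hG).of_iso φ
    rw [extremalAt] at hH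
    split_ifs at hH with ht
    · obtain ⟨φ⟩ := hH
      refine ⟨_, _, key φ baseGraph_mem_family, by rw [card_map, card_baseA ha hn],
        by rw [card_map, card_baseI ha hn], fun _ => ?_⟩
      have hm : ∀ (S : Finset (Fin n)) (v : V), v ∉ S.map φ.toEquiv.symm.toEmbedding ↔ φ v ∉ S :=
        fun S v => by rw [mem_map_equiv]; rfl
      intro u v huA huI hvA hvI huv
      rw [hm] at huA huI hvA hvI
      rw [← φ.map_adj_iff]
      exact restComplete_baseGraph _ _ huA huI hvA hvI fun h' => huv (φ.injective h')
    · obtain ⟨G, hG, ⟨φ⟩⟩ := hH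
      exact ⟨_, _, key φ hG, by rw [card_map, card_baseA ha hn],
        by rw [card_map, card_baseI ha hn], fun h => absurd h ht⟩
  · rintro ⟨A, I, h, hA, hI, hrest⟩
    obtain ⟨G, hG, hiso, hbase⟩ := exists_iso_mem_family hV ha hn h hA hI
    rw [extremalAt]
    split_ifs with ht
    · rw [← hbase (hrest ht)]
      exact hiso
    · exact ⟨G, hG, hiso⟩

theorem degreeChooseSum_of_mem_extremalAt {b t : ℕ} (hV : Fintype.card V = a + i + b)
    (ha : (a : ℤ) = i + ℓ) (hb : 1 ≤ b) (h : H ∈ extremalAt V (a + i + b) ℓ i t) :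
    degreeChooseSum t H = splitValue t a i b := by
  obtain ⟨A, I, hs, hA, hI, hrest⟩ := (mem_extremalAt_iff hV ha (by omega)).1 h
  refine hs.degreeChooseSum_eq hV hA hI ?_
  by_cases ht : t ≤ a + b - 1
  · exact Or.inl (hrest (by push_cast; omega))
  · exact Or.inr (by omega)

theorem degreeChooseSum_baseGraph {b t : ℕ} (ha : (a : ℤ) = i + ℓ) (hb : 1 ≤ b) :
    degreeChooseSum t (baseGraph (a + i + b) ℓ i) = splitValue t a i b := by
  refine degreeChooseSum_of_mem_extremalAt (by simp) ha hb ?_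
  rw [extremalAt]
  split_ifs
  · exact ⟨SimpleGraph.Iso.refl⟩
  · exact ⟨_, baseGraph_mem_family, ⟨SimpleGraph.Iso.refl⟩⟩

end BaseGraph

end Recognition

/-! ### From a single index to the ends of its range. -/

section Extremal

open SimpleGraph Classical

/-- A function that is strictly quasi-convex on an interval of integers is smaller in the interior
than at one of the ends. -/
theorem lt_max_of_quasiconvex {f : ℕ → ℕ} {p q : ℕ}
    (h : ∀ i, p ≤ i → i + 2 ≤ q → f (i + 1) < max (f i) (f (i + 2))) {j : ℕ} (hp : p < j)
    (hq : j < q) : f j < max (f p) (f q) := by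
  by_contra hle
  rw [not_lt] at hle
  obtain ⟨m, hm, hmax⟩ := (Finset.Icc p q).exists_max_image f ⟨j, mem_Icc.2 ⟨hp.le, hq.le⟩⟩
  have hint : ∀ k, p < k → k < q → (∀ x ∈ Finset.Icc p q, f x ≤ f k) → False := by
    intro k hk hk' hall
    obtain ⟨i, rfl⟩ : ∃ i, k = i + 1 := ⟨k - 1, by omega⟩
    have h1 := h i (by omega) (by omega)
    have h2 := hall i (mem_Icc.2 ⟨by omega, by omega⟩)
    have h3 := hall (i + 2) (mem_Icc.2 ⟨by omega, by omega⟩)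
    exact absurd h1 (not_lt.2 (max_le h2 h3))
  rw [mem_Icc] at hm
  have hpj : f p ≤ f j := (le_max_left _ _).trans hle
  have hqj : f q ≤ f j := (le_max_right _ _).trans hle
  -- If the maximum sits at an end, the assumption on j makes j an interior maximiser as well, so
  -- quasi-convexity is contradicted in every case.
  rcases eq_or_lt_of_le hm.1 with rfl | h1
  · exact hint j hp hq fun x hx => (hmax x hx).trans hpj
  rcases eq_or_lt_of_le hm.2 with rfl | h2
  · exact hint j hp hq fun x hx => (hmax x hx).trans hqj
  exact hint m h1 h2 hmax

variable {V : Type*} [Fintype V]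

theorem le_minDegree_iff_ncard [Nonempty V] {G : SimpleGraph V} {d : ℕ} :
    d ≤ G.minDegree ↔ ∀ v, d ≤ (G.neighborSet v).ncard := by
  have hdeg : ∀ v, G.degree v = (G.neighborSet v).ncard := fun v => by
    rw [← card_neighborSet_eq_degree, Set.ncard_eq_toFinset_card', Set.toFinset_card]
  constructor
  · intro h v
    rw [← hdeg]
    exact h.trans (G.minDegree_le_degree v)
  · intro h
    exact G.le_minDegree_of_forall_le_degree d fun v => (h v).trans_eq (hdeg v).symm

/-- An admissible graph is dominated by one of the graphs `G^ℓ_n(i)`. -/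
theorem exists_index_of_admissible {P : HamProperty} {n d t : ℕ} {G : SimpleGraph V}
    (hV : Fintype.card V = n) (hℓ : P.ell ≤ (n : ℤ) - 3) (ht1 : 1 ≤ t) (htn : t ≤ n - 1)
    (hell : -1 ≤ P.ell) (hG : G ∈ admissible V P d) :
    ∃ i : ℕ, iDeg d P.ell ≤ i ∧ (i : ℤ) ≤ iTop n P.ell ∧
      starCount t G ≤ starCount t (baseGraph n P.ell i) ∧
      (starCount t G = starCount t (baseGraph n P.ell i) → G ∈ extremalAt V n P.ell i t) := by
  subst hV
  have : Nonempty V := Fintype.card_pos_iff.1 (by omega)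
  obtain ⟨i, hi1, hi2, hlow, hmid⟩ := P.exists_degree_bound hℓ hG.2
  obtain ⟨a, ha⟩ : ∃ a : ℕ, (a : ℤ) = i + P.ell := ⟨(i + P.ell).toNat, by omega⟩
  obtain ⟨b, hb⟩ : ∃ b : ℕ, Fintype.card V = a + i + b := ⟨Fintype.card V - a - i, by omega⟩
  have hb1 : 1 ≤ b := by omega
  -- Some vertex has degree at most i + ℓ, while every degree is at least d.
  have hdi : iDeg d P.ell ≤ i := by
    obtain ⟨v, hv⟩ := card_pos.1 (show 0 < _ from hi1.trans hlow)
    have h1 := (mem_filter.1 hv).2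
    have h2 := le_minDegree_iff_ncard.1 hG.1 v
    rw [iDeg]
    omega
  obtain ⟨A, I, hdisj, hA, hI, hdeg⟩ := exists_parts (G := G) (a := a) (i := i) (b := b) hb hb1
    (hlow.trans (card_le_card fun v hv => by
      simp only [mem_filter, mem_univ, true_and] at hv ⊢
      omega))
    (by
      have : #{v | (G.neighborSet v).ncard + i + 1 ≤ Fintype.card V} ≤
          #{v | (G.neighborSet v).ncard ≤ a + b - 1} := card_le_card fun v hv => by
        simp only [mem_filter, mem_univ, true_and] at hv ⊢
        omega
      omega)
  have hbase := degreeChooseSum_baseGraph (t := t) ha hb1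
  rw [← hb] at hbase
  refine ⟨i, hdi, by rw [iTop]; omega, ?_, ?_⟩
  · rw [starCount_le_iff, hbase]
    exact degreeChooseSum_le_splitValue hb hA hI hdisj hdeg
  · rw [starCount_eq_iff, hbase]
    intro heq
    obtain ⟨hs, hrest⟩ :=
      isSplit_of_degreeChooseSum_eq hb hA hI hdisj hdeg ht1 (by omega) heq
    rw [mem_extremalAt_iff rfl ha (by omega)]
    exact ⟨A, I, hs, hA, hI, fun h => hrest (by omega)⟩

theorem mem_admissible_of_mem_extremalAt {P : HamProperty} {n d t i : ℕ} {G : SimpleGraph V}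
    (hV : Fintype.card V = n) (hℓ : P.ell ≤ (n : ℤ) - 3) (hell : -1 ≤ P.ell)
    (hdi : iDeg d P.ell ≤ i) (hin : (i : ℤ) ≤ iTop n P.ell)
    (hG : G ∈ extremalAt V n P.ell i t) :
    G ∈ admissible V P d ∧ starCount t G = starCount t (baseGraph n P.ell i) := by
  subst hV
  rw [iDeg] at hdi
  rw [iTop] at hin
  have : Nonempty V := Fintype.card_pos_iff.1 (by omega)
  obtain ⟨a, ha⟩ : ∃ a : ℕ, (a : ℤ) = i + P.ell := ⟨(i + P.ell).toNat, by omega⟩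
  obtain ⟨b, hb⟩ : ∃ b : ℕ, Fintype.card V = a + i + b := ⟨Fintype.card V - a - i, by omega⟩
  have hb1 : 1 ≤ b := by omega
  obtain ⟨A, I, hs, hA, hI, -⟩ := (mem_extremalAt_iff rfl ha (by omega)).1 hG
  have hne : I.Nonempty := by
    rw [← card_pos]; omega
  refine ⟨⟨?_, ?_⟩, ?_⟩
  · rw [le_minDegree_iff_ncard]
    intro v
    have := hs.le_ncard_neighborSet hne v
    omega
  · refine hs.not_holds P hℓ hne ?_ (by omega)
    obtain ⟨v, hv⟩ := card_pos.1 (show 0 < #(A ∪ I)ᶜ by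
      rw [card_rest hb hA hI hs.disjoint]; omega)
    rw [mem_compl, mem_union, not_or] at hv
    exact ⟨v, hv⟩
  · have hbase := degreeChooseSum_baseGraph (t := t) ha hb1
    rw [starCount_eq_iff]
    rw [← hb] at hbase
    rw [hbase]
    exact degreeChooseSum_of_mem_extremalAt hb ha hb1 (hb ▸ hG)

/-- Raising i by one enlarges A by one and shrinks B by two, which is the step pattern of
`splitValue_lt_max`. -/
theorem starCount_baseGraph_lt_max {n t i : ℕ} {ℓ : ℤ} (hell : -1 ≤ ℓ) (hi1 : 1 ≤ i)
    (hin : ((i + 2 : ℕ) : ℤ) ≤ iTop n ℓ) (ht1 : 1 ≤ t) (htn : t ≤ n - 1) :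
    starCount t (baseGraph n ℓ ((i + 1 : ℕ) : ℤ)) <
      max (starCount t (baseGraph n ℓ (i : ℤ))) (starCount t (baseGraph n ℓ ((i + 2 : ℕ) : ℤ))) := by
  rw [iTop] at hin
  obtain ⟨a, ha⟩ : ∃ a : ℕ, (a : ℤ) = i + ℓ := ⟨(i + ℓ).toNat, by omega⟩
  obtain ⟨b, hb⟩ : ∃ b : ℕ, n = a + i + (b + 4) := ⟨n - a - i - 4, by omega⟩
  have hb1 : 1 ≤ b := by omega
  have h0 := degreeChooseSum_baseGraph (t := t) (ℓ := ℓ) (a := a) (i := i) (b := b + 4)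
    ha (by omega)
  have h1 := degreeChooseSum_baseGraph (t := t) (ℓ := ℓ) (a := a + 1) (i := i + 1) (b := b + 2)
    (by push_cast; omega) (by omega)
  have h2 := degreeChooseSum_baseGraph (t := t) (ℓ := ℓ) (a := a + 2) (i := i + 2) (b := b)
    (by push_cast; omega) hb1
  rw [← hb] at h0
  rw [show a + 1 + (i + 1) + (b + 2) = n by omega] at h1
  rw [show a + 2 + (i + 2) + b = n by omega] at h2
  rw [lt_max_iff, starCount_lt_iff, starCount_lt_iff, h0, h1, h2, ← lt_max_iff]
  exact splitValue_lt_max hb1 ht1 (by omega)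

end Extremal

theorem HamProperty.neg_one_le_ell (P : HamProperty) : -1 ≤ P.ell := by
  cases P <;> simp only [HamProperty.ell] <;> omega

/-- The extremal graphs are the ones associated with the ends of the range of the index at which
the maximum is attained. -/
theorem mem_extremal_iff {V : Type*} [Fintype V] {P : HamProperty} {n d t : ℕ}
    (hV : Fintype.card V = n) (hℓ : P.ell ≤ (n : ℤ) - 3) (ht1 : 1 ≤ t) (htn : t ≤ n - 1)
    (hd : (d : ℤ) ≤ ((n : ℤ) + P.ell - 1) / 2) :
    (∀ G ∈ admissible V P d, starCount t G ≤ starBound n P.ell d t) ∧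
    ∀ G, G ∈ extremal V P d t ↔
      (G ∈ extremalAt V n P.ell (iDeg d P.ell) t ∧
        starCount t (baseGraph n P.ell (iDeg d P.ell)) = starBound n P.ell d t) ∨
      (G ∈ extremalAt V n P.ell (iTop n P.ell) t ∧
        starCount t (baseGraph n P.ell (iTop n P.ell)) = starBound n P.ell d t) := by
  have hell := P.neg_one_le_ell
  obtain ⟨p, hp⟩ : ∃ p : ℕ, (p : ℤ) = iDeg d P.ell :=
    ⟨(iDeg d P.ell).toNat, by rw [iDeg]; omega⟩
  obtain ⟨q, hq⟩ : ∃ q : ℕ, (q : ℤ) = iTop n P.ell :=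
    ⟨(iTop n P.ell).toNat, by rw [iTop]; omega⟩
  have hp1 : 1 ≤ p := by rw [iDeg] at hp; omega
  -- Subtracting ℓ from the bound on d gives d - ℓ ≤ i_0, and ℓ ≤ n - 3 gives 1 ≤ i_0.
  have hpq : p ≤ q := by rw [iDeg] at hp; rw [iTop] at hq; omega
  have hint : ∀ j, p < j → j < q →
      starCount t (baseGraph n P.ell (j : ℤ)) < starBound n P.ell d t := by
    intro j hpj hjq
    rw [starBound, ← hp, ← hq]
    refine lt_max_of_quasiconvex (f := fun j : ℕ => starCount t (baseGraph n P.ell (j : ℤ)))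
      ?_ hpj hjq
    intro i hi hi'
    exact starCount_baseGraph_lt_max hell (by omega) (by omega) ht1 htn
  have hle : ∀ j, p ≤ j → j ≤ q →
      starCount t (baseGraph n P.ell (j : ℤ)) ≤ starBound n P.ell d t := by
    intro j hpj hjq
    rcases eq_or_lt_of_le hpj with rfl | h1
    · rw [starBound, hp]; exact le_max_left _ _
    rcases eq_or_lt_of_le hjq with rfl | h2
    · rw [starBound, hq]; exact le_max_right _ _
    exact (hint j h1 h2).le
  refine ⟨fun G hG => ?_, fun G => ⟨fun hG => ?_, fun hG => ?_⟩⟩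
  · obtain ⟨i, h1, h2, h3, -⟩ := exists_index_of_admissible hV hℓ ht1 htn hell hG
    exact h3.trans (hle i (by omega) (by omega))
  · obtain ⟨hadm, heq⟩ := hG
    rw [hV] at heq
    obtain ⟨i, h1, h2, h3, h4⟩ := exists_index_of_admissible hV hℓ ht1 htn hell hadm
    have h5 := hle i (by omega) (by omega)
    have h6 : starCount t G = starCount t (baseGraph n P.ell (i : ℤ)) := by omega
    rcases eq_or_lt_of_le (show p ≤ i by omega) with rfl | h7
    · left
      rw [← hp]
      exact ⟨h4 h6, by omega⟩
    rcases eq_or_lt_of_le (show i ≤ q by omega) with rfl | h8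
    · right
      rw [← hq]
      exact ⟨h4 h6, by omega⟩
    have := hint i h7 h8
    omega
  · rw [extremal, Set.mem_ofPred_eq, hV]
    rcases hG with ⟨h1, h2⟩ | ⟨h1, h2⟩
    · rw [← hp] at h1 h2
      obtain ⟨h3, h4⟩ := mem_admissible_of_mem_extremalAt (d := d) hV hℓ hell
        (by omega) (by omega) h1
      exact ⟨h3, h4.trans h2⟩
    · rw [← hq] at h1 h2
      obtain ⟨h3, h4⟩ := mem_admissible_of_mem_extremalAt (d := d) hV hℓ hell
        (by omega) (by omega) h1
      exact ⟨h3, h4.trans h2⟩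

theorem extremalAt_of_le {V : Type*} {n t : ℕ} {ℓ i : ℤ} (h : (t : ℤ) ≤ n - i - 1) :
    extremalAt V n ℓ i t = copiesOf V (baseGraph n ℓ i) := if_pos h

theorem extremalAt_of_lt {V : Type*} {n t : ℕ} {ℓ i : ℤ} (h : (n : ℤ) - i - 1 < t) :
    extremalAt V n ℓ i t = copiesOfFamily V (family n ℓ i) := if_neg (not_le.2 h)

end StarsHam

end

open StarsHam in
theorem theorem1p7 {V : Type*} [Fintype V] (n : ℕ) (hn : Fintype.card V = n)
    (P : HamProperty) (hP : P.PosParam) (ℓ : ℤ) (hℓ : ℓ = P.ell) (hℓn : ℓ ≤ (n : ℤ) - 3)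
    (t : ℕ) (ht1 : 1 ≤ t) (htn : t ≤ n - 1)
    (d : ℕ) (hd : (d : ℤ) ≤ ((n : ℤ) + ℓ - 1) / 2)
    (i₀ i_d : ℤ) (hi₀ : i₀ = iTop n ℓ) (hi_d : i_d = iDeg d ℓ) :
    -- the number in question is an upper bound
    (∀ G ∈ admissible V P d,
      starCount t G ≤
        max (starCount t (baseGraph n ℓ i_d)) (starCount t (baseGraph n ℓ i₀))) ∧
    -- first case
    (starCount t (baseGraph n ℓ i_d) < starCount t (baseGraph n ℓ i₀) →
      ((t : ℤ) ≤ n - i₀ - 1 →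
        extremal V P d t = copiesOf V (baseGraph n ℓ i₀)) ∧
      ((n : ℤ) - i₀ - 1 < t →
        extremal V P d t = copiesOfFamily V (family n ℓ i₀))) ∧
    -- second case
    (starCount t (baseGraph n ℓ i₀) < starCount t (baseGraph n ℓ i_d) →
      ((t : ℤ) ≤ n - i_d - 1 →
        extremal V P d t = copiesOf V (baseGraph n ℓ i_d)) ∧
      ((n : ℤ) - i_d - 1 < t →
        extremal V P d t = copiesOfFamily V (family n ℓ i_d))) ∧
    -- the case of a tie
    (starCount t (baseGraph n ℓ i_d) = starCount t (baseGraph n ℓ i₀) →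
      ((t : ℤ) ≤ n - i₀ - 1 →
        extremal V P d t = copiesOf V (baseGraph n ℓ i_d) ∪ copiesOf V (baseGraph n ℓ i₀)) ∧
      ((n : ℤ) - i₀ - 1 < t → (t : ℤ) ≤ n - i_d - 1 →
        extremal V P d t =
          copiesOfFamily V (family n ℓ i₀) ∪ copiesOf V (baseGraph n ℓ i_d)) ∧
      ((n : ℤ) - i_d - 1 < t →
        extremal V P d t =
          copiesOfFamily V (family n ℓ i_d) ∪ copiesOfFamily V (family n ℓ i₀))) := by
  subst hℓ hi₀ hi_d
  obtain ⟨hbound, hext⟩ := mem_extremal_iff (V := V) (P := P) hn hℓn ht1 htn hd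
  -- This orders the two thresholds on t, so in a tie the outer ranges of t decide both ends at
  -- once.
  have hle : iDeg d P.ell ≤ iTop n P.ell := by
    rw [iDeg, iTop]; omega
  set i_d := iDeg d P.ell with hi_d
  set i₀ := iTop n P.ell with hi₀
  have hsb : starBound n P.ell d t = max (starCount t (baseGraph n P.ell i_d))
      (starCount t (baseGraph n P.ell i₀)) := rfl
  rw [hsb] at hext
  refine ⟨hbound, fun hlt => ?_, fun hlt => ?_, fun heq => ?_⟩
  · have h : extremal V P d t = extremalAt V n P.ell i₀ t := by
      ext G
      rw [hext, max_eq_right hlt.le]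
      simp [hlt.ne]
    rw [h]
    exact ⟨extremalAt_of_le, extremalAt_of_lt⟩
  · have h : extremal V P d t = extremalAt V n P.ell i_d t := by
      ext G
      rw [hext, max_eq_left hlt.le]
      simp [hlt.ne]
    rw [h]
    exact ⟨extremalAt_of_le, extremalAt_of_lt⟩
  · have h : extremal V P d t = extremalAt V n P.ell i_d t ∪ extremalAt V n P.ell i₀ t := by
      ext G
      rw [hext, heq, max_self]
      simp
    rw [h]
    refine ⟨fun h1 => ?_, fun h1 h2 => ?_, fun h1 => ?_⟩
    · rw [extremalAt_of_le h1, extremalAt_of_le (by omega)]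
    · rw [extremalAt_of_lt h1, extremalAt_of_le h2, Set.union_comm]
    · rw [extremalAt_of_lt h1, extremalAt_of_lt (by omega)]
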